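/- Let $T$ be a complete first-order theory in a countable language and let $\bar M$ be a monster model of $T$: for some uncountable cardinal $\kappa$, $\bar M$ is $\kappa$-saturated and strongly $\kappa$-homogeneous (partial elementary maps with domain of size $<\kappa$ extend to automorphisms); sets of size $<\kappa$ are called small. A global type is a complete type over $\bar M$ in finitely many variables; it is non-algebraic if each of its formulas has infinitely many solutions. For a global type $\mathfrak p(x)$ and $A\subseteq\bar M$, $\mathfrak p_{\upharpoonright A}$ is the set of formulas of $\mathfrak p$ with parameters from $A$, and $\mathfrak p$ is $A$-invariant if, for all formulas $\varphi(x,y)$ over $A$ and all finite tuples $b_1\equiv b_2\,(A)$, $\varphi(x,b_1)\in\mathfrak p$ iff $\varphi(x,b_2)\in\mathfrak p$. A sequence $(a_i\mid i<\alpha)$ of tuples of $\bar M$, $\alpha$ an ordinal, is a Morley sequence in $\mathfrak p$ over $A$ if $a_i\models\mathfrak p_{\upharpoonright A a_{<i}}$ for all $i<\alpha$. Say that a global type $\mathfrak p$ is - generically stable, if it is non-algebraic and there is a small $A$ such that $\mathfrak p$ is $A$-invariant and, for every infinite ordinal $\alpha$, every Morley sequence $(a_i\mid i<\alpha)$ in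 $\mathfrak p$ over $A$ and every formula $\varphi(x)$ with parameters from $\bar M$, the set $\{i<\alpha\mid\ \models\varphi(a_i)\}$ is finite or co-finite in $\alpha$; - regular over $A$, if it is non-algebraic and $A$-invariant and, for every small $B\supseteq A$ and every $a\models\mathfrak p_{\upharpoonright A}$, either $a\models\mathfrak p_{\upharpoonright B}$ or $\mathfrak p_{\upharpoonright B}\vdash\mathfrak p_{\upharpoonright Ba}$. Global types $\mathfrak p$ and $\mathfrak q$ are orthogonal if $\mathfrak p(x)\cup\mathfrak q(y)$ determines a complete type over $\bar M$. Let $A\subseteq\bar M$ be countable and let $\{\mathfrak p_i\mid i\in I\}$ be a countable family of pairwise orthogonal global types, each of which is generically stable and regular over $A$, such that each restriction $\mathfrak p_{i\,\upharpoonright A}$ is non-isolated (no single formula of $\mathfrak p_{i\,\upharpoonright A}$ implies all the others). Then for every function $f:I\to\omega$ there is a countable elementary submodel $M_f\preceq\bar M$ with $A\subseteq M_f$ such that, for every $i\in I$, $\dim_{\mathfrak p_i}(M_f/A)=f(i)$; that is, there are maximal Morley sequences in $\mathfrak p_i$ over $A$ among those consisting of tuples of $M_f$, and all of them have cardinality $f(i)$.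 -/

import Mathlib

open FirstOrder FirstOrder.Language Cardinal

universe u v w

namespace GenStab

section

variable {L : FirstOrder.Language.{u, v}} {M : Type w} [L.Structure M]

variable (L M) in
/-- `M` is `κ`-saturated: every set of formulas in one variable over fewer than `κ` parameters
which is finitely satisfiable in `M` is realized in `M`. -/
def IsSaturated (κ : Cardinal.{w}) : Prop :=
  ∀ A : Set M, #A < κ → ∀ Γ : Set (L[[A]].Formula (Fin 1)),
    (∀ Γ₀ : Finset (L[[A]].Formula (Fin 1)), (Γ₀ : Set (L[[A]].Formula (Fin 1))) ⊆ Γ →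
      ∃ a : Fin 1 → M, ∀ φ ∈ Γ₀, φ.Realize a) →
    ∃ a : Fin 1 → M, ∀ φ ∈ Γ, φ.Realize a

variable (L M) in
/-- `M` is strongly `κ`-homogeneous: every partial elementary map whose domain has fewer than `κ`
elements extends to an automorphism. -/
def IsStronglyHomogeneous (κ : Cardinal.{w}) : Prop :=
  ∀ A : Set M, #A < κ → ∀ g : A → M,
    (∀ φ : L.Formula A, φ.Realize (fun a : A => (a : M)) ↔ φ.Realize g) →
    ∃ σ : M ≃[L] M, ∀ a : A, σ (a : M) = g a

variable (L M) in
/-- `M` is a monster model, where "small" means "of cardinality less than `κ`". -/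
structure IsMonster (κ : Cardinal.{w}) : Prop where
  saturated : IsSaturated L M κ
  homogeneous : IsStronglyHomogeneous L M κ

variable (L M) in
/-- Global types: complete types over `M` in the variables indexed by `α`. -/
abbrev GlobalType (α : Type) : Type _ :=
  (L.elementaryDiagram M).CompleteType α

/-- The formula `ψ(x)` with parameters from `M` belongs to the global type `p(x)`. -/
def Mem {α : Type} (ψ : L[[M]].Formula α) (p : GlobalType L M α) : Prop :=
  Formula.equivSentence ψ ∈ p

/-- A formula with parameters from `A`, seen as a formula with parameters from `M`. -/
def lift {α : Type} {A : Set M} (ψ : L[[A]].Formula α) : L[[M]].Formula α :=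
  (L.lhomWithConstantsMap (Subtype.val : A → M)).onFormula ψ

/-- For a formula `φ(x, y)` with parameters from `A` and a tuple `b` of elements of `M`, the
formula `φ(x, b)`. -/
def inst {α β : Type} {A : Set M} (φ : L[[A]].Formula (α ⊕ β)) (b : β → M) : L[[M]].Formula α :=
  BoundedFormula.subst (lift φ) (Sum.elim Term.var fun j => (L.con (b j)).term)

/-- The restriction `p ↾ A`, as a set of formulas with parameters from `A`. -/
def restrict {α : Type} (p : GlobalType L M α) (A : Set M) : Set (L[[A]].Formula α) :=
  {ψ | Mem (lift ψ) p}

/-- The tuple `a` of elements of `M` realizes `p ↾ A`. -/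
def Realizes {α : Type} (p : GlobalType L M α) (A : Set M) (a : α → M) : Prop :=
  ∀ ψ ∈ restrict p A, ψ.Realize a

/-- `p` is non-algebraic: each of its formulas has infinitely many solutions. -/
def NonAlgebraic {α : Type} (p : GlobalType L M α) : Prop :=
  ∀ ψ : L[[M]].Formula α, Mem ψ p → {a : α → M | ψ.Realize a}.Infinite

variable (L) in
/-- `b₁ ≡ b₂ (A)`: the tuples `b₁` and `b₂` have the same type over `A`. -/
def SameType {β : Type} (A : Set M) (b₁ b₂ : β → M) : Prop :=
  ∀ χ : L[[A]].Formula β, χ.Realize b₁ ↔ χ.Realize b₂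

/-- `p` is `A`-invariant. -/
def Invariant {α : Type} (p : GlobalType L M α) (A : Set M) : Prop :=
  ∀ (k : ℕ) (φ : L[[A]].Formula (α ⊕ Fin k)) (b₁ b₂ : Fin k → M),
    SameType L A b₁ b₂ → (Mem (inst φ b₁) p ↔ Mem (inst φ b₂) p)

/-- `p ↾ A` is isolated: some formula of `p ↾ A` implies all formulas of `p ↾ A`. -/
def IsIsolated {α : Type} (p : GlobalType L M α) (A : Set M) : Prop :=
  ∃ φ ∈ restrict p A, ∀ ψ ∈ restrict p A, ∀ a : α → M, φ.Realize a → ψ.Realize a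

/-- Orthogonality of global types: `p(x) ∪ q(y)` determines a complete type over `M`. -/
def Orthogonal {α β : Type} (p : GlobalType L M α) (q : GlobalType L M β) : Prop :=
  ∃! r : GlobalType L M (α ⊕ β),
    (∀ ψ : L[[M]].Formula α, Mem ψ p → Mem (ψ.relabel Sum.inl) r) ∧
    (∀ ψ : L[[M]].Formula β, Mem ψ q → Mem (ψ.relabel Sum.inr) r)

/-- The set `A ∪ a_{<α}`, where `a_{<α}` consists of the entries of the tuples `a i`, `i < α`. -/
def below {n : ℕ} (A : Set M) (a : Ordinal.{w} → Fin n → M) (α : Ordinal.{w}) : Set M :=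
  A ∪ {m | ∃ i < α, ∃ k, m = a i k}

/-- `(a i | i < α)` is a Morley sequence in `p` over `A`; values `a i` with `α ≤ i` play no
role. -/
def IsMorley {n : ℕ} (p : GlobalType L M (Fin n)) (A : Set M) (α : Ordinal.{w})
    (a : Ordinal.{w} → Fin n → M) : Prop :=
  ∀ i < α, Realizes p (below A a i) (a i)

/-- `p` is generically stable, small sets being those of cardinality less than `κ`. -/
def GenericallyStable {n : ℕ} (κ : Cardinal.{w}) (p : GlobalType L M (Fin n)) : Prop :=
  NonAlgebraic p ∧ ∃ A : Set M, #A < κ ∧ Invariant p A ∧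
    ∀ α : Ordinal.{w}, Ordinal.omega0 ≤ α → ∀ a : Ordinal.{w} → Fin n → M, IsMorley p A α a →
      ∀ φ : L[[M]].Formula (Fin n),
        {i | i < α ∧ φ.Realize (a i)}.Finite ∨ {i | i < α ∧ ¬ φ.Realize (a i)}.Finite

/-- `p` is regular over `A`: it is non-algebraic, `A`-invariant, and for every small `B ⊇ A` and
every `a ⊨ p ↾ A`, either `a ⊨ p ↾ B` or `p ↾ B ⊢ p ↾ Ba`. -/
def RegularOver {n : ℕ} (κ : Cardinal.{w}) (p : GlobalType L M (Fin n)) (A : Set M) : Prop :=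
  NonAlgebraic p ∧ Invariant p A ∧
    ∀ B : Set M, A ⊆ B → #B < κ → ∀ a : Fin n → M, Realizes p A a →
      Realizes p B a ∨ ∀ c : Fin n → M, Realizes p B c → Realizes p (B ∪ Set.range a) c

/-- `(a i | i < α)` is a maximal Morley sequence in `p` over `A` among those in `N`. -/
def IsMaximalMorleyIn {n : ℕ} (p : GlobalType L M (Fin n)) (A N : Set M) (α : Ordinal.{w})
    (a : Ordinal.{w} → Fin n → M) : Prop :=
  IsMorley p A α a ∧ (∀ i < α, ∀ k, a i k ∈ N) ∧
    ¬ ∃ b : Fin n → M, (∀ k, b k ∈ N) ∧ Realizes p (below A a α) b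

/-- `dim_p(N / A)` is well defined and equal to `c`: there are maximal Morley sequences in `p` over
`A` among those in `N`, and all of them have cardinality `c`. -/
def HasDim {n : ℕ} (p : GlobalType L M (Fin n)) (N A : Set M) (c : Cardinal.{w}) : Prop :=
  (∃ α a, IsMaximalMorleyIn p A N α a) ∧ ∀ α a, IsMaximalMorleyIn p A N α a → α.card = c

end

end GenStab

/-! Choose realizations `b ⟨i, j⟩` of the `p i`, for `j < f i`, each generic over `A` and all the
others; call `B` the set `A` with all of them adjoined. For fixed `i` they form a Morley sequence of
length `f i` over `A`, and it is maximal in every model containing `B` that omits `p i` restricted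
to `A` and these `f i` tuples. Such a countable model comes from omitting types
(`IsSaturated.exists_omitting`), provided that no consistent formula over `B` implies this
restriction.

Suppose some formula does. By weak orthogonality (`RegularOver.realizes_union_of_orthogonal`), the
tuples belonging to other indices add nothing to the restriction, so the formula isolates `p i` over
`A` and finitely many of the `b x`. By `NoSplitting.exists_isolating` these can be removed one at a
time: the type of `b x` is definable, so the formula can be replaced by its definition along that
type. In the end a formula over `A` isolates `p i` over `A`, contrary to assumption.

Generic stability enters through `NoSplitting`, which concerns Morley sequences of length `ω + ω`
over some small set unrelated to `A`. It yields definability over every small set of invariance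
(`NoSplitting.definable`) and symmetry of independence (`NoSplitting.commute_self`); orthogonal
invariant types commute as well (`Orthogonal.commute`). Commutation produces the independent family,
and with regularity it gives the exchange property (`RegularOver.exchange`), by which all maximal
Morley sequences have the same size. -/

namespace GenStab

/-! ### Global types as ultrafilters of definable sets; orthogonality by compactness. -/

variable {L : FirstOrder.Language.{u, v}} {M : Type w} [L.Structure M]

/-- The `M`-definable set `S` belongs to the global type `p`. -/
def Contains {α : Type} (p : GlobalType L M α) (S : Set (α → M)) : Prop :=
  ∃ ψ : L[[M]].Formula α, Mem ψ p ∧ {a | ψ.Realize a} = S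

/-- The fibre of `S` over the parameter tuple `b`. -/
def fib {α β : Type} (S : Set (α ⊕ β → M)) (b : β → M) : Set (α → M) :=
  {x | Sum.elim x b ∈ S}

@[simp]
theorem mem_fib {α β : Type} {S : Set (α ⊕ β → M)} {b : β → M} {x : α → M} :
    x ∈ fib S b ↔ Sum.elim x b ∈ S := Iff.rfl

theorem fib_compl {α β : Type} (S : Set (α ⊕ β → M)) (b : β → M) : fib Sᶜ b = (fib S b)ᶜ := rfl

instance isExpansionOn_constants_val {A : Set M} :
    (L.lhomWithConstantsMap (Subtype.val : A → M)).IsExpansionOn M :=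
  haveI : (LHom.constantsOnMap (Subtype.val : A → M)).IsExpansionOn M :=
    constantsOnMap_isExpansionOn rfl
  LHom.sumMap_isExpansionOn _ _ _

theorem realize_lift {α : Type} {A : Set M} (ψ : L[[A]].Formula α) (a : α → M) :
    (lift ψ).Realize a ↔ ψ.Realize a :=
  LHom.realize_onFormula _ _

theorem realize_inst {α β : Type} {A : Set M} (φ : L[[A]].Formula (α ⊕ β)) (b : β → M)
    (a : α → M) : (inst φ b).Realize a ↔ φ.Realize (Sum.elim a b) := by
  rw [← realize_lift φ]
  unfold inst Formula.Realize
  rw [BoundedFormula.realize_subst]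
  have : (fun i => Term.realize a ((Sum.elim Term.var fun j => (L.con (b j)).term :
      α ⊕ β → L[[M]].Term α) i)) = Sum.elim a b := by
    funext i
    rcases i with i | i
    · rfl
    · simp only [Sum.elim_inr, Term.realize_constants]
      rfl
  rw [this]

/-- An empty `M` would put `∀ x, ⊥` into the elementary diagram, but the type is realized in a
nonempty model of it. -/
theorem nonempty_of_globalType {α : Type} (p : GlobalType L M α) : Nonempty M := by
  obtain ⟨N, -⟩ := Theory.exists_modelType_is_realized_in _ p
  by_contra hM
  rw [not_nonempty_iff] at hM
  have h : ((⊥ : L[[M]].BoundedFormula Empty 1).all : L[[M]].Sentence) ∈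
      L.elementaryDiagram M := by
    rw [mem_completeTheory]
    simp [Sentence.Realize, Formula.Realize]
  have := N.is_model.realize_of_mem _ h
  simp [Sentence.Realize, Formula.Realize] at this

/-- The universal closure of `φ → ψ` is a sentence of the elementary diagram, so it holds in any
model realizing `p`. Consequently membership in `p` depends only on the solution set, which
justifies `Contains`. -/
theorem mem_mono {α : Type} [Finite α] {p : GlobalType L M α} {φ ψ : L[[M]].Formula α}
    (h : ∀ a : α → M, φ.Realize a → ψ.Realize a) (hφ : Mem φ p) : Mem ψ p := by
  obtain ⟨N, v, rfl⟩ := Theory.exists_modelType_is_realized_in _ p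
  unfold Mem at *
  rw [Theory.CompleteType.formula_mem_typeOf] at *
  have h2 : (((φ.imp ψ).relabel (Sum.inr : α → Empty ⊕ α)).iAlls α : L[[M]].Sentence) ∈
      L.elementaryDiagram M := by
    rw [mem_completeTheory]
    simp only [Sentence.Realize, Formula.realize_iAlls, Formula.realize_relabel,
      Sum.elim_comp_inr, Formula.realize_imp]
    exact h
  have := N.is_model.realize_of_mem _ h2
  simp only [Sentence.Realize, Formula.realize_iAlls, Formula.realize_relabel,
      Sum.elim_comp_inr, Formula.realize_imp] at this
  exact this v hφ

theorem mem_not {α : Type} {p : GlobalType L M α} {φ : L[[M]].Formula α} :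
    Mem φ.not p ↔ ¬ Mem φ p := by
  obtain ⟨N, v, rfl⟩ := Theory.exists_modelType_is_realized_in _ p
  simp [Mem]

theorem mem_inf {α : Type} {p : GlobalType L M α} {φ ψ : L[[M]].Formula α} :
    Mem (φ ⊓ ψ) p ↔ Mem φ p ∧ Mem ψ p := by
  obtain ⟨N, v, rfl⟩ := Theory.exists_modelType_is_realized_in _ p
  simp [Mem]

theorem contains_setOf {α : Type} [Finite α] {p : GlobalType L M α} {φ : L[[M]].Formula α} :
    Contains p {a | φ.Realize a} ↔ Mem φ p := by
  refine ⟨fun ⟨ψ, h, e⟩ => mem_mono (fun a ha => ?_) h, fun h => ⟨φ, h, rfl⟩⟩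
  have : a ∈ {a | ψ.Realize a} := ha
  rwa [e] at this

theorem definable_univ_iff {α : Type} {S : Set (α → M)} :
    (Set.univ : Set M).Definable L S ↔ ∃ ψ : L[[M]].Formula α, {a | ψ.Realize a} = S := by
  constructor
  · rintro ⟨ψ, rfl⟩
    exact ⟨lift ψ, Set.ext fun a => realize_lift ψ a⟩
  · rintro ⟨ψ, rfl⟩
    rw [Set.definable_iff_exists_formula_sum]
    let χ : L.Formula (M ⊕ α) := BoundedFormula.constantsVarsEquiv ψ
    refine ⟨Formula.relabel (Sum.map (fun m => (⟨m, trivial⟩ : (Set.univ : Set M))) id) χ, ?_⟩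
    ext a
    simp only [Set.mem_ofPred_eq, Formula.realize_relabel]
    unfold Formula.Realize
    rw [← BoundedFormula.realize_constantsVarsEquiv]
    simp only [χ]
    apply iff_of_eq
    congr 1
    funext i
    rcases i with i | i <;> rfl

variable {α β : Type} {p : GlobalType L M α} {q : GlobalType L M β} {A : Set M}

theorem Contains.definable {S : Set (α → M)} (h : Contains p S) :
    (Set.univ : Set M).Definable L S :=
  definable_univ_iff.2 (h.imp fun _ h => h.2)

theorem Contains.inter {S T : Set (α → M)} (h : Contains p S) (h' : Contains p T) :
    Contains p (S ∩ T) := by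
  obtain ⟨φ, hφ, rfl⟩ := h
  obtain ⟨ψ, hψ, rfl⟩ := h'
  refine ⟨φ ⊓ ψ, mem_inf.2 ⟨hφ, hψ⟩, ?_⟩
  ext a
  simp

/-- A set of formulas over `M` which is finitely satisfiable in `M` extends to a global type. -/
theorem exists_type_of_finitely_satisfiable {G : Set (L[[M]].Formula α)}
    (h : ∀ G₀ : Set (L[[M]].Formula α), G₀.Finite → G₀ ⊆ G →
      ∃ a : α → M, ∀ χ ∈ G₀, χ.Realize a) [Nonempty M] :
    ∃ r : GlobalType L M α, ∀ χ ∈ G, Mem χ r := by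
  have hs : ((L[[M]].lhomWithConstants α).onTheory (L.elementaryDiagram M) ∪
      Formula.equivSentence '' G).IsSatisfiable := by
    rw [Theory.isSatisfiable_iff_isFinitelySatisfiable]
    intro T₀ hT₀
    obtain ⟨v, hv⟩ := h (G ∩ Formula.equivSentence ⁻¹' (T₀ : Set L[[M]][[α]].Sentence))
      (Set.Finite.subset (T₀.finite_toSet.preimage Formula.equivSentence.injective.injOn)
        Set.inter_subset_right) Set.inter_subset_left
    let : (constantsOn α).Structure M := constantsOn.structure v
    have hm : M ⊨ (T₀ : L[[M]][[α]].Theory) := by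
      refine ⟨fun {σ} hσ => ?_⟩
      rcases hT₀ hσ with hσ' | ⟨χ, hχ, rfl⟩
      · exact ((LHom.onTheory_model (M := M) (L[[M]].lhomWithConstants α)
          (L.elementaryDiagram M)).2 inferInstance).realize_of_mem _ hσ'
      · exact (Formula.realize_equivSentence (L := L[[M]]) M χ).2 (hv χ ⟨hχ, hσ⟩)
    exact Theory.Model.isSatisfiable M
  by_contra! hcon
  refine (Theory.CompleteType.setOfPred_subset_eq_empty_iff _).1 ?_ hs
  rw [Set.eq_empty_iff_forall_notMem]
  intro r hr
  obtain ⟨χ, hχ, hn⟩ := hcon r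
  exact hn (hr ⟨χ, hχ, rfl⟩)

variable [Finite α] [Finite β]

theorem Contains.mono {S T : Set (α → M)} (h : Contains p S) (hST : S ⊆ T)
    (hT : (Set.univ : Set M).Definable L T) : Contains p T := by
  obtain ⟨ψ, rfl⟩ := definable_univ_iff.1 hT
  obtain ⟨φ, hφ, rfl⟩ := h
  exact contains_setOf.2 (mem_mono hST hφ)

theorem contains_compl {S : Set (α → M)} (h : (Set.univ : Set M).Definable L S) :
    Contains p Sᶜ ↔ ¬ Contains p S := by
  obtain ⟨ψ, rfl⟩ := definable_univ_iff.1 h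
  have : {a : α → M | ψ.Realize a}ᶜ = {a | ψ.not.Realize a} := by
    ext a
    simp
  rw [this, contains_setOf, contains_setOf, mem_not]

theorem contains_univ : Contains p Set.univ := by
  by_contra h
  have h1 := (contains_compl (p := p) (Set.definable_univ (L := L))).2 h
  exact h (h1.mono (Set.subset_univ _) Set.definable_univ)

theorem Contains.nonempty {S : Set (α → M)} (h : Contains p S) : S.Nonempty := by
  by_contra hS
  rw [Set.not_nonempty_iff_eq_empty] at hS
  subst hS
  have := (contains_compl (p := p) h.definable).1 (by simpa using contains_univ)
  exact this h

theorem realizes_iff {a : α → M} :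
    Realizes p A a ↔ ∀ S, A.Definable L S → Contains p S → a ∈ S := by
  constructor
  · rintro h S ⟨ψ, rfl⟩ hc
    refine h ψ ?_
    rw [show {a : α → M | ψ.Realize a} = {a | (lift ψ).Realize a} from
      Set.ext fun a => (realize_lift ψ a).symm, contains_setOf] at hc
    exact hc
  · intro h ψ hψ
    refine h _ ⟨ψ, rfl⟩ ?_
    rw [show {a : α → M | ψ.Realize a} = {a | (lift ψ).Realize a} from
      Set.ext fun a => (realize_lift ψ a).symm, contains_setOf]
    exact hψ

theorem sameType_iff {β : Type} {b₁ b₂ : β → M} :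
    SameType L A b₁ b₂ ↔ ∀ S, A.Definable L S → (b₁ ∈ S ↔ b₂ ∈ S) :=
  ⟨fun h _ ⟨ψ, e⟩ => e ▸ h ψ, fun h ψ => h _ ⟨ψ, rfl⟩⟩

theorem SameType.comp {β γ : Type} {b₁ b₂ : β → M} (h : SameType L A b₁ b₂) (g : γ → β) :
    SameType L A (b₁ ∘ g) (b₂ ∘ g) :=
  sameType_iff.2 fun _ hS => sameType_iff.1 h _ (hS.preimage_comp g)

theorem SameType.symm {β : Type} {b₁ b₂ : β → M} (h : SameType L A b₁ b₂) :
    SameType L A b₂ b₁ := fun χ => (h χ).symm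

theorem SameType.mono {β : Type} {b₁ b₂ : β → M} {C : Set M} (h : SameType L C b₁ b₂)
    (hAC : A ⊆ C) : SameType L A b₁ b₂ :=
  sameType_iff.2 fun _ hS => sameType_iff.1 h _ (hS.mono hAC)

theorem Invariant.contains_iff (h : Invariant p A) {S : Set (α ⊕ β → M)} (hS : A.Definable L S)
    {b₁ b₂ : β → M} (hb : SameType L A b₁ b₂) : Contains p (fib S b₁) ↔ Contains p (fib S b₂) := by
  obtain ⟨k, ⟨e⟩⟩ := Finite.exists_equiv_fin β
  obtain ⟨φ, hφ⟩ := hS.preimage_comp (Sum.map id e)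
  have key : ∀ b : β → M, fib S b = {a | (inst φ (b ∘ e.symm)).Realize a} := by
    intro b
    ext a
    have : Sum.elim a (b ∘ e.symm) ∈ {v | φ.Realize v} ↔ Sum.elim a b ∈ S := by
      rw [← hφ, Set.mem_preimage]
      apply iff_of_eq
      congr 1
      funext i
      rcases i with i | i <;> simp
    simp only [mem_fib, Set.mem_ofPred_eq, realize_inst]
    exact this.symm
  rw [key, key, contains_setOf, contains_setOf]
  exact h k φ _ _ (hb.comp _)

theorem isIsolated_iff : IsIsolated p A ↔ ∃ S, A.Definable L S ∧ Contains p S ∧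
    ∀ a ∈ S, Realizes p A a := by
  have key : ∀ ψ : L[[A]].Formula α, ψ ∈ restrict p A ↔ Contains p {a | ψ.Realize a} := by
    intro ψ
    rw [show {a : α → M | ψ.Realize a} = {a | (lift ψ).Realize a} from
      Set.ext fun a => (realize_lift ψ a).symm, contains_setOf]
    rfl
  constructor
  · rintro ⟨φ, hφ, h⟩
    exact ⟨_, ⟨φ, rfl⟩, (key φ).1 hφ, fun a ha ψ hψ => h ψ hψ a ha⟩
  · rintro ⟨S, ⟨φ, rfl⟩, hc, h⟩
    exact ⟨φ, (key φ).2 hc, fun ψ hψ a ha => h a ha ψ hψ⟩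

/-- Global types `p(x)` and `q(y)` all of whose formulas are compatible with the formula `S(x, y)`
have a common extension containing `S`. -/
theorem exists_type_of_compatible {φ : L[[M]].Formula (α ⊕ β)}
    (h : ∀ P Q, Contains p P → Contains q Q → ∃ x ∈ P, ∃ y ∈ Q, φ.Realize (Sum.elim x y)) :
    ∃ r : GlobalType L M (α ⊕ β), (∀ ψ : L[[M]].Formula α, Mem ψ p → Mem (ψ.relabel Sum.inl) r) ∧
      (∀ ψ : L[[M]].Formula β, Mem ψ q → Mem (ψ.relabel Sum.inr) r) ∧ Mem φ r := by
  have key : ∀ G₀ : Set (L[[M]].Formula (α ⊕ β)), G₀.Finite →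
      G₀ ⊆ Formula.relabel Sum.inl '' {ψ | Mem ψ p} ∪ Formula.relabel Sum.inr '' {ψ | Mem ψ q} ∪
        {φ} →
      ∃ P Q, Contains p P ∧ Contains q Q ∧ ∀ x ∈ P, ∀ y ∈ Q, φ.Realize (Sum.elim x y) →
        ∀ χ ∈ G₀, χ.Realize (Sum.elim x y) := by
    intro G₀ hG₀
    induction G₀, hG₀ using Set.Finite.induction_on with
    | empty => exact fun _ => ⟨_, _, contains_univ, contains_univ, by simp⟩
    | @insert χ s _ _ ih =>
      intro hs
      obtain ⟨P, Q, hP, hQ, hPQ⟩ := ih ((Set.subset_insert _ _).trans hs)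
      rcases hs (Set.mem_insert _ _) with (⟨ψ, hψ, rfl⟩ | ⟨ψ, hψ, rfl⟩) | hχ
      · refine ⟨_, Q, hP.inter (contains_setOf.2 hψ), hQ, fun x hx y hy hφ χ hχ => ?_⟩
        rcases hχ with rfl | hχ
        · simpa [Formula.realize_relabel] using! hx.2
        · exact hPQ x hx.1 y hy hφ χ hχ
      · refine ⟨P, _, hP, hQ.inter (contains_setOf.2 hψ), fun x hx y hy hφ χ hχ => ?_⟩
        rcases hχ with rfl | hχ
        · simpa [Formula.realize_relabel] using! hy.2
        · exact hPQ x hx y hy.1 hφ χ hχ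
      · refine ⟨P, Q, hP, hQ, fun x hx y hy hφ χ' hχ' => ?_⟩
        rcases hχ' with rfl | hχ'
        · rw [Set.mem_singleton_iff] at hχ
          rwa [hχ]
        · exact hPQ x hx y hy hφ χ' hχ'
  have hfs : ∀ G₀ : Set (L[[M]].Formula (α ⊕ β)), G₀.Finite →
      G₀ ⊆ Formula.relabel Sum.inl '' {ψ | Mem ψ p} ∪ Formula.relabel Sum.inr '' {ψ | Mem ψ q} ∪
        {φ} → ∃ a : α ⊕ β → M, ∀ χ ∈ G₀, χ.Realize a := by
    intro G₀ hf hs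
    obtain ⟨P, Q, hP, hQ, hPQ⟩ := key G₀ hf hs
    obtain ⟨x, hx, y, hy, hxy⟩ := h P Q hP hQ
    exact ⟨_, hPQ x hx y hy hxy⟩
  have hM : Nonempty M := nonempty_of_globalType p
  obtain ⟨r, hr⟩ := exists_type_of_finitely_satisfiable hfs
  exact ⟨r, fun ψ hψ => hr _ (Or.inl (Or.inl ⟨ψ, hψ, rfl⟩)),
    fun ψ hψ => hr _ (Or.inl (Or.inr ⟨ψ, hψ, rfl⟩)), hr _ (Or.inr rfl)⟩

/-- If no box decided `S`, then `S` and its complement would both be compatible with `p(x) ∪ q(y)`,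
giving two distinct completions. -/
theorem Orthogonal.exists_box (h : Orthogonal p q) {S : Set (α ⊕ β → M)}
    (hS : (Set.univ : Set M).Definable L S) :
    ∃ P Q, Contains p P ∧ Contains q Q ∧
      ((∀ x ∈ P, ∀ y ∈ Q, Sum.elim x y ∈ S) ∨ (∀ x ∈ P, ∀ y ∈ Q, Sum.elim x y ∉ S)) := by
  obtain ⟨φ, rfl⟩ := definable_univ_iff.1 hS
  by_contra! hcon
  obtain ⟨r₁, h₁, h₁', h₁''⟩ := exists_type_of_compatible (p := p) (q := q) (φ := φ)
    (fun P Q hP hQ => (hcon P Q hP hQ).2)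
  obtain ⟨r₂, h₂, h₂', h₂''⟩ := exists_type_of_compatible (p := p) (q := q) (φ := φ.not)
    (fun P Q hP hQ => by
      obtain ⟨x, hx, y, hy, hxy⟩ := (hcon P Q hP hQ).1
      exact ⟨x, hx, y, hy, hxy⟩)
  have := h.unique ⟨h₁, h₁'⟩ ⟨h₂, h₂'⟩
  subst this
  exact (mem_not.1 h₂'') h₁''

end GenStab

namespace GenStab

/-! ### Fibres, finite supports and projections of definable sets. -/

section Definability

variable {L : FirstOrder.Language.{u, v}} {M : Type w} [L.Structure M] {A C : Set M}
variable {α β γ : Type}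

theorem definable_fib {S : Set (α ⊕ β → M)} (hS : A.Definable L S) (hAC : A ⊆ C) {b : β → M}
    (hb : ∀ j, b j ∈ C) : C.Definable L (fib S b) := by
  rw [Set.definable_iff_exists_formula_sum] at hS ⊢
  obtain ⟨φ, rfl⟩ := hS
  refine ⟨φ.relabel (Sum.elim (fun a : A => Sum.inl ⟨(a : M), hAC a.2⟩)
    (Sum.elim Sum.inr fun j => Sum.inl ⟨b j, hb j⟩)), ?_⟩
  ext x
  simp only [mem_fib, Set.mem_ofPred_eq, Formula.realize_relabel]
  apply iff_of_eq
  congr 1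
  funext i
  rcases i with i | i | i <;> rfl

theorem exists_eq_fib {b : β → M} {S : Set (α → M)} (hS : (C ∪ Set.range b).Definable L S) :
    ∃ T, C.Definable L T ∧ S = fib T b := by
  classical
  obtain ⟨φ, rfl⟩ := Set.definable_iff_exists_formula_sum.1 hS
  have key : ∀ m : (C ∪ Set.range b : Set M), ∃ s : C ⊕ (α ⊕ β), ∀ x : α → M,
      Sum.elim (fun c : C => (c : M)) (Sum.elim x b) s = m := by
    rintro ⟨m, hm | ⟨j, rfl⟩⟩
    · exact ⟨Sum.inl ⟨m, hm⟩, fun _ => rfl⟩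
    · exact ⟨Sum.inr (Sum.inr j), fun _ => rfl⟩
  choose s hs using key
  refine ⟨_, Set.definable_iff_exists_formula_sum.2
    ⟨φ.relabel (Sum.elim s fun i => Sum.inr (Sum.inl i)), rfl⟩, ?_⟩
  ext x
  simp only [mem_fib, Set.mem_ofPred_eq, Formula.realize_relabel]
  apply iff_of_eq
  congr 1
  funext i
  rcases i with i | i
  · exact (hs i x).symm
  · rfl

/-- Every definable set is a fibre of a `∅`-definable set. -/
theorem exists_eq_fib_empty {S : Set (α → M)} (hS : C.Definable L S) :
    ∃ (k : ℕ) (d : Fin k → M) (T : Set (α ⊕ Fin k → M)), (∀ j, d j ∈ C) ∧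
      (∅ : Set M).Definable L T ∧ S = fib T d := by
  obtain ⟨A₀, hA₀, hd⟩ := Set.definable_iff_finitely_definable.1 hS
  obtain ⟨T, hT, h⟩ := exists_eq_fib (C := ∅) (b := fun j => (A₀.equivFin.symm j : M))
    (hd.mono (B := ∅ ∪ Set.range fun j => (A₀.equivFin.symm j : M)) (fun m hm => Or.inr
      ⟨A₀.equivFin ⟨m, hm⟩, by simp⟩))
  exact ⟨_, _, T, fun j => hA₀ (A₀.equivFin.symm j).2, hT, h⟩

theorem exists_finite_support {S : Set (β → M)} (hS : A.Definable L S) :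
    ∃ (F : Finset β) (T : Set (F → M)), A.Definable L T ∧
      S = {x | (fun i : F => x i) ∈ T} := by
  classical
  obtain ⟨φ, rfl⟩ := hS
  refine ⟨φ.freeVarFinset, _, ⟨φ.restrictFreeVar id, rfl⟩, ?_⟩
  ext x
  exact (BoundedFormula.realize_restrictFreeVar (φ := φ) (f := id)
    (v := fun i => x i) x (fun _ => rfl)).symm

/-- A definable set depends on finitely many coordinates, so projecting from infinitely many
variables reduces to projecting from finitely many. -/
theorem definable_proj {S : Set (β → M)} (hS : A.Definable L S) [Finite γ] (g : γ → β) :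
    A.Definable L ((fun x : β → M => x ∘ g) '' S) := by
  classical
  rcases S.eq_empty_or_nonempty with rfl | ⟨x₀, hx₀⟩
  · simp
  cases nonempty_fintype γ
  obtain ⟨F, T, hT, rfl⟩ := exists_finite_support hS
  let δ : Finset β := F ∪ Finset.univ.image g
  let ι : F → δ := fun i => ⟨i, Finset.mem_union_left _ i.2⟩
  let g' : γ → δ := fun i => ⟨g i, Finset.mem_union_right _ (by simp)⟩
  convert (hT.preimage_comp ι).image_comp g' using 1
  ext y
  constructor
  · rintro ⟨x, hx, rfl⟩
    exact ⟨fun i => x i, hx, rfl⟩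
  · rintro ⟨x, hx, rfl⟩
    refine ⟨fun i => if h : i ∈ δ then x ⟨i, h⟩ else x₀ i, ?_, ?_⟩
    · have : (fun i : F => if h : (i : β) ∈ δ then x ⟨i, h⟩ else x₀ i) = x ∘ ι := by
        funext i
        exact dif_pos (ι i).2
      simp only [Set.mem_ofPred_eq, this]
      exact hx
    · funext i
      exact dif_pos (g' i).2

theorem sameType_of_finite {b b' : β → M}
    (h : ∀ F : Finset β, SameType L A (fun i : F => b i) (fun i : F => b' i)) :
    SameType L A b b' := by
  rw [sameType_iff]
  intro S hS
  obtain ⟨F, T, hT, rfl⟩ := exists_finite_support hS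
  exact sameType_iff.1 (h F) T hT

theorem SameType.of_mem {b b' : β → M} (h : SameType L A b b') {S : Set (β → M)}
    (hS : A.Definable L S) (hb : b ∈ S) : b' ∈ S := (sameType_iff.1 h S hS).1 hb

theorem definable_sInter {F : Set (Set (β → M))} (hF : F.Finite) (h : ∀ S ∈ F, A.Definable L S) :
    A.Definable L (⋂₀ F) := by
  induction F, hF using Set.Finite.induction_on with
  | empty => simp
  | insert _ _ ih =>
    rw [Set.sInter_insert]
    exact (h _ (Set.mem_insert _ _)).inter (ih fun S hS => h S (Set.mem_insert_of_mem _ hS))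

theorem definable_sUnion {F : Set (Set (β → M))} (hF : F.Finite) (h : ∀ S ∈ F, A.Definable L S) :
    A.Definable L (⋃₀ F) := by
  induction F, hF using Set.Finite.induction_on with
  | empty => simp
  | insert _ _ ih =>
    rw [Set.sUnion_insert]
    exact (h _ (Set.mem_insert _ _)).union (ih fun S hS => h S (Set.mem_insert_of_mem _ hS))

end Definability

/-! ### Saturation in countably many variables. -/

section Saturation

variable {L : FirstOrder.Language.{u, v}} {M : Type w} [L.Structure M] {C : Set M}
variable {κ : Cardinal.{w}} {β γ : Type}

theorem mk_union_lt {A B : Set M} (hκ : ℵ₀ ≤ κ) (hA : #A < κ) (hB : #B < κ) :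
    #(A ∪ B : Set M) < κ :=
  (mk_union_le A B).trans_lt (add_lt_of_lt hκ hA hB)

theorem mk_lt_of_countable {A : Set M} (hκ : ℵ₀ < κ) (hA : A.Countable) : #A < κ :=
  (le_aleph0_iff_set_countable.2 hA).trans_lt hκ

theorem nonempty_sInter_of_directed {F F₀ : Set (Set (β → M))} (hne : F.Nonempty)
    (h : ∀ S ∈ F, ∀ T ∈ F, S ∩ T ∈ F) (hF₀ : F₀.Finite) (hsub : F₀ ⊆ F) :
    ∃ S ∈ F, S ⊆ ⋂₀ F₀ := by
  induction F₀, hF₀ using Set.Finite.induction_on with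
  | empty => exact hne.imp fun S hS => ⟨hS, by simp⟩
  | @insert T s _ _ ih =>
    obtain ⟨S, hS, hSs⟩ := ih ((Set.subset_insert _ _).trans hsub)
    exact ⟨_, h T (hsub (Set.mem_insert _ _)) S hS, by
      rw [Set.sInter_insert]
      exact Set.inter_subset_inter_right T hSs⟩

theorem IsSaturated.exists_mem_fin_one (hs : IsSaturated L M κ) (hC : #C < κ)
    {F : Set (Set (Fin 1 → M))} (hne : F.Nonempty) (hF : ∀ S ∈ F, C.Definable L S)
    (hdir : ∀ S ∈ F, ∀ T ∈ F, S ∩ T ∈ F) (hn : ∀ S ∈ F, S.Nonempty) : ∃ x, ∀ S ∈ F, x ∈ S := by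
  obtain ⟨a, ha⟩ := hs C hC {φ | {x | φ.Realize x} ∈ F} (fun Γ₀ hΓ₀ => by
    obtain ⟨S, hS, hS'⟩ := nonempty_sInter_of_directed hne hdir
      (Γ₀.finite_toSet.image fun φ : L[[C]].Formula (Fin 1) => {x : Fin 1 → M | φ.Realize x})
      (by rintro _ ⟨φ, hφ, rfl⟩; exact hΓ₀ hφ)
    obtain ⟨a, ha⟩ := hn S hS
    exact ⟨a, fun φ hφ => hS' ha _ ⟨φ, hφ, rfl⟩⟩)
  refine ⟨a, fun S hS => ?_⟩
  obtain ⟨φ, rfl⟩ := hF S hS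
  exact ha φ hS

/-- The coordinates are chosen one at a time, keeping every set of `F` consistent with the finite
tuple chosen so far. Finite supports make this enough in the limit. -/
theorem IsSaturated.exists_mem_nat (hs : IsSaturated L M κ) (hκ : ℵ₀ < κ) (hC : #C < κ)
    {F : Set (Set (ℕ → M))} (hne : F.Nonempty) (hF : ∀ S ∈ F, C.Definable L S)
    (hdir : ∀ S ∈ F, ∀ T ∈ F, S ∩ T ∈ F) (hn : ∀ S ∈ F, S.Nonempty) : ∃ x, ∀ S ∈ F, x ∈ S := by
  have step : ∀ (k : ℕ) (c : ℕ → M), (∀ S ∈ F, ∃ x ∈ S, ∀ j < k, x j = c j) →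
      ∃ m, ∀ S ∈ F, ∃ x ∈ S, ∀ j < k + 1, x j = Function.update c k m j := by
    intro k c hc
    let D : Set (ℕ → M) → Set (Fin 1 → M) := fun S =>
      fib ((fun x : ℕ → M => x ∘ Sum.elim (fun _ : Fin 1 => k) (fun j : Fin k => (j : ℕ))) '' S)
        (fun j => c j)
    have hD : ∀ S m, m ∈ D S ↔ ∃ x ∈ S, (∀ j < k, x j = c j) ∧ x k = m 0 := by
      intro S m
      constructor
      · rintro ⟨x, hx, h⟩
        exact ⟨x, hx, fun j hj => congrFun h (Sum.inr ⟨j, hj⟩), congrFun h (Sum.inl 0)⟩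
      · rintro ⟨x, hx, h, h'⟩
        refine ⟨x, hx, ?_⟩
        funext i
        rcases i with i | i
        · rw [Subsingleton.elim i 0]
          exact h'
        · exact h i i.2
    obtain ⟨m, hm⟩ := hs.exists_mem_fin_one (C := C ∪ Set.range fun j : Fin k => c j)
      (mk_union_lt hκ.le hC (mk_lt_of_countable hκ (Set.countable_range _)))
      -- Definable supersets of the sets `D S` are used because `D (S ∩ T)` is only contained in `D
      -- S ∩ D T`.
      (F := {X | ∃ S ∈ F, D S ⊆ X ∧
        (C ∪ Set.range fun j : Fin k => c j).Definable L X}) (by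
        obtain ⟨S, hS⟩ := hne
        exact ⟨Set.univ, S, hS, Set.subset_univ _, Set.definable_univ⟩)
      (fun X ⟨_, _, _, h⟩ => h)
      (by
        rintro X ⟨S, hS, h, h'⟩ Y ⟨T, hT, k, k'⟩
        refine ⟨S ∩ T, hdir S hS T hT, fun m hm => ?_, h'.inter k'⟩
        obtain ⟨x, hx, hx'⟩ := (hD _ _).1 hm
        exact ⟨h ((hD _ _).2 ⟨x, hx.1, hx'⟩), k ((hD _ _).2 ⟨x, hx.2, hx'⟩)⟩)
      (by
        rintro X ⟨S, hS, h, h'⟩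
        obtain ⟨x, hx, hx'⟩ := hc S hS
        exact ⟨fun _ => x k, h ((hD _ _).2 ⟨x, hx, hx', rfl⟩)⟩)
    refine ⟨m 0, fun S hS => ?_⟩
    obtain ⟨x, hx, h, h'⟩ := (hD S m).1 (hm _ ⟨S, hS, subset_rfl,
      definable_fib (definable_proj (hF S hS) _) Set.subset_union_left
        fun j => Or.inr ⟨j, rfl⟩⟩)
    refine ⟨x, hx, fun j hj => ?_⟩
    rcases Nat.lt_succ_iff_lt_or_eq.1 hj with hj | rfl
    · rw [Function.update_of_ne hj.ne]
      exact h j hj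
    · rw [Function.update_self, h']
  obtain ⟨S₀, hS₀⟩ := hne
  obtain ⟨x₀, -⟩ := hn S₀ hS₀
  have : Nonempty M := ⟨x₀ 0⟩
  choose! m hm using step
  let c : ℕ → ℕ → M := fun k => Nat.rec x₀ (fun k c => Function.update c k (m k c)) k
  have hc1 : ∀ k, c (k + 1) = Function.update (c k) k (m k (c k)) := fun k => rfl
  have hc : ∀ k, ∀ S ∈ F, ∃ x ∈ S, ∀ j < k, x j = c k j := by
    intro k
    induction k with
    | zero => exact fun S hS => (hn S hS).imp fun x hx => ⟨hx, by simp⟩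
    | succ k ih => exact hm k _ ih
  have hst : ∀ k, ∀ j < k, c k j = c (j + 1) j := by
    intro k
    induction k with
    | zero => simp
    | succ k ih =>
      intro j hj
      rcases Nat.lt_succ_iff_lt_or_eq.1 hj with hj | rfl
      · rw [hc1, Function.update_of_ne hj.ne]
        exact ih j hj
      · rfl
  refine ⟨fun j => c (j + 1) j, fun S hS => ?_⟩
  obtain ⟨F', T, hT, rfl⟩ := exists_finite_support (hF S hS)
  obtain ⟨x, hx, hx'⟩ := hc (F'.sup id + 1) _ hS
  have : (fun i : F' => x i) = fun i : F' => c (i + 1) i := by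
    funext i
    have hi : (i : ℕ) < F'.sup id + 1 := Nat.lt_succ_of_le (Finset.le_sup (f := id) i.2)
    rw [hx' i hi, hst _ i hi]
  simp only [Set.mem_ofPred_eq] at hx ⊢
  rwa [← this]

/-- Realizing directed families of definable sets in countably many variables. -/
theorem IsSaturated.exists_mem [Countable β] (hs : IsSaturated L M κ) (hκ : ℵ₀ < κ) (hC : #C < κ)
    {F : Set (Set (β → M))} (hne : F.Nonempty) (hF : ∀ S ∈ F, C.Definable L S)
    (hdir : ∀ S ∈ F, ∀ T ∈ F, S ∩ T ∈ F) (hn : ∀ S ∈ F, S.Nonempty) : ∃ x, ∀ S ∈ F, x ∈ S := by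
  obtain ⟨e, he⟩ := exists_injective_nat β
  rcases isEmpty_or_nonempty β with hβ | ⟨⟨j₀⟩⟩
  · refine ⟨isEmptyElim, fun S hS => ?_⟩
    obtain ⟨x, hx⟩ := hn S hS
    rwa [Subsingleton.elim isEmptyElim x]
  · obtain ⟨x, hx⟩ := hs.exists_mem_nat hκ hC (F := (fun S => (fun x : ℕ → M => x ∘ e) ⁻¹' S) '' F)
      (hne.image _) (by rintro _ ⟨S, hS, rfl⟩; exact (hF S hS).preimage_comp e)
      (by rintro _ ⟨S, hS, rfl⟩ _ ⟨T, hT, rfl⟩; exact ⟨_, hdir S hS T hT, rfl⟩)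
      (by
        rintro _ ⟨S, hS, rfl⟩
        obtain ⟨x, hx⟩ := hn S hS
        refine ⟨Function.extend e x fun _ => x j₀, ?_⟩
        rw [Set.mem_preimage, Function.extend_comp he]
        exact hx)
    exact ⟨x ∘ e, fun S hS => hx _ ⟨S, hS, rfl⟩⟩

/-- Realizing families of definable sets with the finite intersection property. -/
theorem IsSaturated.exists_mem_of_fip [Countable β] (hs : IsSaturated L M κ) (hκ : ℵ₀ < κ)
    (hC : #C < κ) {F : Set (Set (β → M))} (hF : ∀ S ∈ F, C.Definable L S)
    (hn : ∀ F₀ ⊆ F, F₀.Finite → (⋂₀ F₀).Nonempty) : ∃ x, ∀ S ∈ F, x ∈ S := by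
  obtain ⟨x, hx⟩ := hs.exists_mem hκ hC (F := Set.sInter '' {F₀ | F₀ ⊆ F ∧ F₀.Finite})
    ⟨_, ∅, ⟨Set.empty_subset _, Set.finite_empty⟩, rfl⟩
    (by rintro _ ⟨F₀, h, rfl⟩; exact definable_sInter h.2 fun S hS => hF S (h.1 hS))
    (by
      rintro _ ⟨F₀, h, rfl⟩ _ ⟨F₁, h', rfl⟩
      exact ⟨F₀ ∪ F₁, ⟨Set.union_subset h.1 h'.1, h.2.union h'.2⟩, Set.sInter_union _ _⟩)
    (by rintro _ ⟨F₀, h, rfl⟩; exact hn F₀ h.1 h.2)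
  exact ⟨x, fun S hS => hx _ ⟨{S}, ⟨Set.singleton_subset_iff.2 hS, Set.finite_singleton _⟩,
    Set.sInter_singleton S⟩⟩

/-- The type of `e` over `C` and `b` is transported to `b'`. It stays consistent because the
projection of a `C`-definable set containing `(e, b)` is `C`-definable and contains `b`, hence `b'`.
-/
theorem IsSaturated.exists_sameType_extension [Countable β] [Finite γ] (hs : IsSaturated L M κ)
    (hκ : ℵ₀ < κ) (hC : #C < κ) {b b' : β → M} (h : SameType L C b b') (e : γ → M) :
    ∃ e' : γ → M, SameType L C (Sum.elim e b) (Sum.elim e' b') := by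
  obtain ⟨e', he'⟩ := hs.exists_mem hκ (C := C ∪ Set.range b')
    (mk_union_lt hκ.le hC (mk_lt_of_countable hκ (Set.countable_range _)))
    (F := (fun S => fib S b') '' {S : Set (γ ⊕ β → M) | C.Definable L S ∧ Sum.elim e b ∈ S})
    ⟨_, Set.univ, ⟨Set.definable_univ, trivial⟩, rfl⟩
    (by
      rintro _ ⟨S, hS, rfl⟩
      exact definable_fib hS.1 Set.subset_union_left fun j => Or.inr ⟨j, rfl⟩)
    (by
      rintro _ ⟨S, hS, rfl⟩ _ ⟨T, hT, rfl⟩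
      exact ⟨S ∩ T, ⟨hS.1.inter hT.1, hS.2, hT.2⟩, rfl⟩)
    (by
      rintro _ ⟨S, hS, rfl⟩
      have hd := (hS.1.preimage_comp (Sum.swap : γ ⊕ β → β ⊕ γ)).exists_of_finite
      obtain ⟨u, hu⟩ := h.of_mem hd ⟨e, by
        rw [Set.mem_preimage]
        convert hS.2 using 1
        funext i
        rcases i with i | i <;> rfl⟩
      refine ⟨u, ?_⟩
      rw [Set.mem_preimage] at hu
      rw [mem_fib]
      convert hu using 1
      funext i
      rcases i with i | i <;> rfl)
  refine ⟨e', sameType_iff.2 fun S hS => ⟨fun h => he' _ ⟨S, ⟨hS, h⟩, rfl⟩, fun h => ?_⟩⟩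
  by_contra hcon
  exact he' _ ⟨Sᶜ, ⟨hS.compl, hcon⟩, rfl⟩ h

/-- A set which is not `C`-definable is split by some complete type over `C`. -/
theorem IsSaturated.exists_split [Countable β] (hs : IsSaturated L M κ) (hκ : ℵ₀ < κ) (hC : #C < κ)
    {D : Set (β → M)} (hD : ¬ C.Definable L D) :
    ∃ c, ∀ S, C.Definable L S → c ∈ S → (∃ x ∈ S, x ∈ D) ∧ ∃ x ∈ S, x ∉ D := by
  by_contra! hcon
  have hcov : ∀ c, ∃ S, C.Definable L S ∧ c ∈ S ∧ (S ⊆ D ∨ S ⊆ Dᶜ) := by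
    intro c
    obtain ⟨S, hS, hc, h⟩ := hcon c
    by_cases hx : ∃ x ∈ S, x ∈ D
    · exact ⟨S, hS, hc, Or.inl fun x hxS => h hx x hxS⟩
    · push Not at hx
      exact ⟨S, hS, hc, Or.inr hx⟩
  -- Compactness: finitely many `C`-definable sets, each inside `D` or inside its complement, cover
  -- the space. Those inside `D` then have union `D`.
  have : ∃ F₀ ⊆ {S : Set (β → M) | C.Definable L S ∧ (Sᶜ ⊆ D ∨ Sᶜ ⊆ Dᶜ)}, F₀.Finite ∧
      ¬ (⋂₀ F₀).Nonempty := by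
    by_contra! h
    obtain ⟨x, hx⟩ := hs.exists_mem_of_fip hκ hC
      (F := {S : Set (β → M) | C.Definable L S ∧ (Sᶜ ⊆ D ∨ Sᶜ ⊆ Dᶜ)}) (fun S hS => hS.1) h
    obtain ⟨S, hS, hxS, h'⟩ := hcov x
    exact hx Sᶜ ⟨hS.compl, by rwa [compl_compl]⟩ hxS
  obtain ⟨F₀, hsub, hfin, hemp⟩ := this
  apply hD
  have : D = ⋃₀ (compl '' {S ∈ F₀ | Sᶜ ⊆ D}) := by
    ext x
    constructor
    · intro hx
      by_contra hcon'
      refine hemp ⟨x, fun S hS => ?_⟩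
      by_contra hxS
      rcases (hsub hS).2 with h | h
      · exact hcon' ⟨Sᶜ, ⟨S, ⟨hS, h⟩, rfl⟩, hxS⟩
      · exact h hxS hx
    · rintro ⟨_, ⟨S, hS, rfl⟩, hx⟩
      exact hS.2 hx
  rw [this]
  refine definable_sUnion ((hfin.subset (Set.sep_subset _ _)).image _) ?_
  rintro _ ⟨S, hS, rfl⟩
  exact (hsub hS.1).1.compl

end Saturation

end GenStab

namespace GenStab

/-! ### Realizations of invariant types and Morley sequences. -/

section Realizations

variable {L : FirstOrder.Language.{u, v}} {M : Type w} [L.Structure M] {A B C : Set M}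
variable {κ : Cardinal.{w}} {α β : Type} [Finite α] [Finite β]
variable {p : GlobalType L M α} {q : GlobalType L M β}

theorem SameType.sum_swap {γ δ : Type} {a a' : γ → M} {b b' : δ → M}
    (h : SameType L C (Sum.elim a b) (Sum.elim a' b')) :
    SameType L C (Sum.elim b a) (Sum.elim b' a') := by
  have := h.comp (Sum.swap : δ ⊕ γ → γ ⊕ δ)
  rwa [Sum.elim_swap, Sum.elim_swap] at this

theorem SameType.sum_left {γ δ : Type} {a a' : γ → M} {b b' : δ → M}
    (h : SameType L C (Sum.elim a b) (Sum.elim a' b')) : SameType L C a a' := h.comp Sum.inl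

theorem SameType.sum_right {γ δ : Type} {a a' : γ → M} {b b' : δ → M}
    (h : SameType L C (Sum.elim a b) (Sum.elim a' b')) : SameType L C b b' := h.comp Sum.inr

theorem SameType.seq_apply {γ δ : Type} {e e' : δ → M} {a a' : ℕ → γ → M}
    (h : SameType L C (Sum.elim e fun x : ℕ × γ => a x.1 x.2)
      (Sum.elim e' fun x : ℕ × γ => a' x.1 x.2)) (i : ℕ) :
    SameType L C (Sum.elim (a i) e) (Sum.elim (a' i) e') := by
  have := h.comp (Sum.map id fun j => (i, j) : δ ⊕ γ → δ ⊕ (ℕ × γ))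
  rw [Sum.elim_comp_map, Sum.elim_comp_map] at this
  exact this.sum_swap

theorem Realizes.mono {a : α → M} (h : Realizes p B a) (hAB : A ⊆ B) : Realizes p A a :=
  realizes_iff.2 fun S hS => realizes_iff.1 h S (hS.mono hAB)

theorem Realizes.mem_iff {a : α → M} (h : Realizes p C a) {S : Set (α → M)}
    (hS : C.Definable L S) : a ∈ S ↔ Contains p S := by
  refine ⟨fun ha => ?_, realizes_iff.1 h S hS⟩
  by_contra hcon
  exact realizes_iff.1 h Sᶜ hS.compl
    ((contains_compl (hS.mono (Set.subset_univ _))).2 hcon) ha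

theorem Realizes.sameType {a a' : α → M} (h : Realizes p C a) (h' : Realizes p C a') :
    SameType L C a a' :=
  sameType_iff.2 fun _ hS => (h.mem_iff hS).trans (h'.mem_iff hS).symm

/-- A tuple realizing `p` over every finite subset of `B` realizes `p` over `B`. -/
theorem realizes_of_finite {a : α → M}
    (h : ∀ F : Finset M, (F : Set M) ⊆ B → Realizes p (F : Set M) a) : Realizes p B a := by
  refine realizes_iff.2 fun S hS hc => ?_
  obtain ⟨F, hF, hd⟩ := Set.definable_iff_finitely_definable.1 hS
  exact realizes_iff.1 (h F hF) S hd hc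

theorem IsSaturated.exists_realizes (hs : IsSaturated L M κ) (hκ : ℵ₀ < κ) (hC : #C < κ)
    (p : GlobalType L M α) : ∃ a, Realizes p C a := by
  obtain ⟨a, ha⟩ := hs.exists_mem hκ hC (F := {S | C.Definable L S ∧ Contains p S})
    ⟨_, Set.definable_univ, contains_univ⟩ (fun S hS => hS.1)
    (fun S hS T hT => ⟨hS.1.inter hT.1, hS.2.inter hT.2⟩) (fun S hS => hS.2.nonempty)
  exact ⟨a, realizes_iff.2 fun S hS hc => ha S ⟨hS, hc⟩⟩

/-- The finitely many parameters from `C` are moved into the tuple: if `b₁ ≡ b₂` over `C`, then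
`(b₁, d) ≡ (b₂, d)` over `A` for `d` in `C`. -/
theorem Invariant.mono (h : Invariant p A) (hAC : A ⊆ C) : Invariant p C := by
  intro k φ b₁ b₂ hb
  have key : ∀ b : Fin k → M, Mem (inst φ b) p ↔ Contains p (fib {v | φ.Realize v} b) := by
    intro b
    rw [← contains_setOf]
    apply iff_of_eq
    congr 1
    ext a
    exact realize_inst φ b a
  rw [key, key]
  obtain ⟨l, d, T, hd, hT, h'⟩ := exists_eq_fib_empty (L := L) (C := C)
    (S := {v : α ⊕ Fin k → M | φ.Realize v}) ⟨φ, rfl⟩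
  have hT' := (hT.mono (Set.empty_subset A)).preimage_comp
    (Sum.elim (Sum.elim Sum.inl (Sum.inr ∘ Sum.inl)) (Sum.inr ∘ Sum.inr) :
      (α ⊕ Fin k) ⊕ Fin l → α ⊕ (Fin k ⊕ Fin l))
  have hfib : ∀ b : Fin k → M, fib {v | φ.Realize v} b = fib ((fun g : α ⊕ (Fin k ⊕ Fin l) → M =>
      g ∘ (Sum.elim (Sum.elim Sum.inl (Sum.inr ∘ Sum.inl)) (Sum.inr ∘ Sum.inr) :
      (α ⊕ Fin k) ⊕ Fin l → α ⊕ (Fin k ⊕ Fin l))) ⁻¹' T) (Sum.elim b d) := by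
    intro b
    rw [h']
    ext x
    simp only [mem_fib, Set.mem_preimage]
    apply iff_of_eq
    congr 1
    funext i
    rcases i with (i | i) | i <;> rfl
  rw [hfib, hfib]
  refine h.contains_iff hT' (sameType_iff.2 fun S hS => ?_)
  exact sameType_iff.1 hb (fib S d) (definable_fib hS hAC hd)

theorem Invariant.sameType_sumElim (hp : Invariant p C) {d d' : β → M} (h : SameType L C d d')
    {a a' : α → M} (ha : Realizes p (C ∪ Set.range d) a)
    (ha' : Realizes p (C ∪ Set.range d') a') : SameType L C (Sum.elim a d) (Sum.elim a' d') := by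
  refine sameType_iff.2 fun S hS => ?_
  have h1 := ha.mem_iff (definable_fib hS Set.subset_union_left (b := d) fun j => Or.inr ⟨j, rfl⟩)
  have h2 := ha'.mem_iff
    (definable_fib hS Set.subset_union_left (b := d') fun j => Or.inr ⟨j, rfl⟩)
  exact h1.trans ((hp.contains_iff hS h).trans h2.symm)

theorem Invariant.realizes_of_sameType (hp : Invariant p C) {d d' : β → M} {a a' : α → M}
    (h : SameType L C (Sum.elim a d) (Sum.elim a' d')) (ha : Realizes p (C ∪ Set.range d) a) :
    Realizes p (C ∪ Set.range d') a' := by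
  refine realizes_iff.2 fun S hS hc => ?_
  obtain ⟨T, hT, rfl⟩ := exists_eq_fib hS
  have h1 : Contains p (fib T d) := (hp.contains_iff hT h.sum_right).2 hc
  exact h.of_mem hT (realizes_iff.1 ha _
    (definable_fib hT Set.subset_union_left fun j => Or.inr ⟨j, rfl⟩) h1)

/-- The entries of the tuples `a j`, `j < i`. -/
def initial {α : Type} (a : ℕ → α → M) (i : ℕ) : Set M := {m | ∃ j < i, ∃ k, a j k = m}

/-- The entries of the tuples `a j`. -/
def entries {α : Type} (a : ℕ → α → M) : Set M := {m | ∃ j k, a j k = m}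

theorem initial_subset_entries {α : Type} (a : ℕ → α → M) (i : ℕ) : initial a i ⊆ entries a :=
  fun _ ⟨j, _, k, h⟩ => ⟨j, k, h⟩

theorem initial_succ {α : Type} (a : ℕ → α → M) (i : ℕ) :
    initial a (i + 1) = initial a i ∪ Set.range (a i) := by
  ext m
  constructor
  · rintro ⟨j, hj, k, rfl⟩
    rcases Nat.lt_succ_iff_lt_or_eq.1 hj with hj | rfl
    · exact Or.inl ⟨j, hj, k, rfl⟩
    · exact Or.inr ⟨k, rfl⟩
  · rintro (⟨j, hj, k, rfl⟩ | ⟨k, rfl⟩)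
    · exact ⟨j, Nat.lt_succ_of_lt hj, k, rfl⟩
    · exact ⟨i, Nat.lt_succ_self i, k, rfl⟩

@[simp]
theorem initial_zero {α : Type} (a : ℕ → α → M) : initial a 0 = ∅ := by
  ext m
  simp [initial]

theorem initial_eq_range {α : Type} (a : ℕ → α → M) (i : ℕ) :
    initial a i = Set.range fun x : Fin i × α => a x.1 x.2 := by
  ext m
  constructor
  · rintro ⟨j, hj, k, rfl⟩
    exact ⟨(⟨j, hj⟩, k), rfl⟩
  · rintro ⟨⟨j, k⟩, rfl⟩
    exact ⟨j, j.2, k, rfl⟩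

theorem countable_entries (a : ℕ → α → M) : (entries a).Countable := by
  have : entries a = Set.range fun x : ℕ × α => a x.1 x.2 := by
    ext m
    simp [entries]
  rw [this]
  exact Set.countable_range _

theorem countable_initial (a : ℕ → α → M) (i : ℕ) : (initial a i).Countable :=
  (countable_entries a).mono (initial_subset_entries a i)

/-- Morley sequences of order type `ω`. -/
def IsMorleySeq {α : Type} (p : GlobalType L M α) (B : Set M) (a : ℕ → α → M) : Prop :=
  ∀ i, Realizes p (B ∪ initial a i) (a i)

theorem IsMorleySeq.mono {a : ℕ → α → M} (h : IsMorleySeq p B a) (hAB : A ⊆ B) :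
    IsMorleySeq p A a :=
  fun i => (h i).mono (Set.union_subset_union_left _ hAB)

theorem IsMorleySeq.realizes {a : ℕ → α → M} (h : IsMorleySeq p B a) (i : ℕ) :
    Realizes p B (a i) := (h i).mono Set.subset_union_left

theorem IsMorleySeq.tail {a : ℕ → α → M} (h : IsMorleySeq p B a) :
    IsMorleySeq p (B ∪ Set.range (a 0)) (fun i => a (i + 1)) := by
  intro i
  refine (h (i + 1)).mono ?_
  rintro m ((hm | ⟨k, rfl⟩) | ⟨j, hj, k, rfl⟩)
  · exact Or.inl hm
  · exact Or.inr ⟨0, i.succ_pos, k, rfl⟩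
  · exact Or.inr ⟨j + 1, Nat.succ_lt_succ hj, k, rfl⟩

theorem IsSaturated.exists_isMorleySeq (hs : IsSaturated L M κ) (hκ : ℵ₀ < κ) (hC : #C < κ)
    (p : GlobalType L M α) : ∃ a, IsMorleySeq p C a := by
  have hr : ∀ B : Set M, #B < κ → ∃ a, Realizes p B a := fun B hB => hs.exists_realizes hκ hB p
  obtain ⟨a₀, -⟩ := hr C hC
  have : Nonempty (α → M) := ⟨a₀⟩
  choose! r hr using hr
  let c : ℕ → Set M := fun k => Nat.rec C (fun _ B => B ∪ Set.range (r B)) k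
  have hc : ∀ i, c i = C ∪ initial (fun i => r (c i)) i := by
    intro i
    induction i with
    | zero => simp [c]
    | succ i ih =>
      rw [initial_succ, ← Set.union_assoc, ← ih]
  refine ⟨fun i => r (c i), fun i => ?_⟩
  rw [← hc]
  refine hr _ ?_
  rw [hc]
  exact mk_union_lt hκ.le hC (mk_lt_of_countable hκ (countable_initial _ _))

/-- Induction on the length: by invariance, the type of the next term over `C` and the earlier ones
is determined by the type of the earlier ones. -/
theorem IsMorleySeq.sameType_initial (hp : Invariant p C) {a a' : ℕ → α → M}
    (h : IsMorleySeq p C a) (h' : IsMorleySeq p C a') (k : ℕ) :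
    SameType L C (fun x : Fin k × α => a x.1 x.2) (fun x => a' x.1 x.2) := by
  induction k with
  | zero =>
    refine sameType_iff.2 fun S _ => ?_
    rw [Subsingleton.elim (fun x : Fin 0 × α => a x.1 x.2) (fun x => a' x.1 x.2)]
  | succ k ih =>
    have h1 := h k
    have h2 := h' k
    rw [initial_eq_range] at h1 h2
    have h3 := (hp.sameType_sumElim ih h1 h2).comp (fun x : Fin (k + 1) × α =>
      (Fin.lastCases (Sum.inl x.2) (fun j => Sum.inr (j, x.2)) x.1 : α ⊕ (Fin k × α)))
    have h4 : ∀ b : ℕ → α → M, (Sum.elim (b k) fun x : Fin k × α => b x.1 x.2) ∘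
        (fun x : Fin (k + 1) × α =>
          (Fin.lastCases (Sum.inl x.2) (fun j => Sum.inr (j, x.2)) x.1 : α ⊕ (Fin k × α))) =
        fun x => b x.1 x.2 := by
      intro b
      funext x
      obtain ⟨j, l⟩ := x
      induction j using Fin.lastCases <;> simp
    rwa [h4, h4] at h3

theorem IsMorleySeq.sameType (hp : Invariant p C) {a a' : ℕ → α → M}
    (h : IsMorleySeq p C a) (h' : IsMorleySeq p C a') :
    SameType L C (fun x : ℕ × α => a x.1 x.2) (fun x => a' x.1 x.2) := by
  refine sameType_of_finite fun F => ?_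
  exact (h.sameType_initial hp h' (F.sup Prod.fst + 1)).comp fun x : F =>
    (⟨x.1.1, Nat.lt_succ_of_le (Finset.le_sup (f := Prod.fst) x.2)⟩, x.1.2)

end Realizations

/-! ### Generic stability: definability and commutation. -/

section GenericStability

variable {L : FirstOrder.Language.{u, v}} {M : Type w} [L.Structure M] {A B C : Set M}
variable {κ : Cardinal.{w}} {α β : Type} [Finite α] [Finite β]
variable {p : GlobalType L M α} {q : GlobalType L M β}

/-- No definable set separates the two halves of a Morley sequence of order type `ω + ω` over a set
containing `A`. -/
def NoSplitting {α : Type} (p : GlobalType L M α) (A : Set M) : Prop :=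
  ∀ B, A ⊆ B → ∀ a a', IsMorleySeq p B a → IsMorleySeq p (B ∪ entries a) a' →
    ∀ S, (Set.univ : Set M).Definable L S → ¬ ((∀ i, a i ∈ S) ∧ ∀ i, a' i ∉ S)

theorem GenericallyStable.exists_noSplitting {n : ℕ} {p : GlobalType L M (Fin n)}
    (h : GenericallyStable κ p) : ∃ A : Set M, #A < κ ∧ NoSplitting p A := by
  obtain ⟨-, A, hA, -, h⟩ := h
  refine ⟨A, hA, fun B hAB a a' ha ha' S hS ⟨hin, hout⟩ => ?_⟩
  obtain ⟨φ, rfl⟩ := definable_univ_iff.1 hS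
  -- The concatenation of the two sequences has length `ω + ω`, and `S` holds on the first half and
  -- fails on the second: neither finite nor co-finite.
  let s : Ordinal.{w} → Fin n → M := fun o =>
    if o < Ordinal.omega0 then a (toNat o.card) else a' (toNat (o - Ordinal.omega0).card)
  have hs : ∀ k : ℕ, s k = a k := by
    intro k
    simp [s, Ordinal.natCast_lt_omega0]
  have hs' : ∀ k : ℕ, s (Ordinal.omega0 + k) = a' k := by
    intro k
    simp [s]
  have hcase : ∀ o < Ordinal.omega0 + Ordinal.omega0,
      (∃ k : ℕ, o = k) ∨ ∃ k : ℕ, o = Ordinal.omega0 + k := by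
    intro o ho
    rcases lt_or_ge o Ordinal.omega0 with h | h
    · exact Or.inl (Ordinal.lt_omega0.1 h)
    · right
      rw [← Ordinal.add_sub_cancel_of_le h] at ho ⊢
      obtain ⟨k, hk⟩ := Ordinal.lt_omega0.1 (lt_of_add_lt_add_left ho)
      exact ⟨k, by rw [hk]⟩
  have hM : IsMorley p A (Ordinal.omega0 + Ordinal.omega0) s := by
    intro o ho
    rcases hcase o ho with ⟨k, rfl⟩ | ⟨k, rfl⟩
    · rw [hs]
      refine (ha k).mono ?_
      rintro m (hm | ⟨j, hj, l, rfl⟩)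
      · exact Or.inl (hAB hm)
      · obtain ⟨j, rfl⟩ := Ordinal.lt_omega0.1 (hj.trans (Ordinal.natCast_lt_omega0 k))
        exact Or.inr ⟨j, by exact_mod_cast hj, l, by rw [hs]⟩
    · rw [hs']
      refine (ha' k).mono ?_
      rintro m (hm | ⟨j, hj, l, rfl⟩)
      · exact Or.inl (Or.inl (hAB hm))
      · rcases hcase j (hj.trans ho) with ⟨j, rfl⟩ | ⟨j, rfl⟩
        · exact Or.inl (Or.inr ⟨j, l, by rw [hs]⟩)
        · exact Or.inr ⟨j, by exact_mod_cast lt_of_add_lt_add_left hj, l, by rw [hs']⟩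
  have hlt : ∀ k : ℕ, (k : Ordinal.{w}) < Ordinal.omega0 + Ordinal.omega0 := fun k =>
    (Ordinal.natCast_lt_omega0 k).trans_le le_self_add
  have hlt' : ∀ k : ℕ, Ordinal.omega0 + (k : Ordinal.{w}) < Ordinal.omega0 + Ordinal.omega0 :=
    fun k => by simp
  rcases h _ le_self_add s hM φ with hf | hf
  · refine Set.infinite_of_injective_forall_mem (f := fun k : ℕ => (k : Ordinal.{w}))
      (fun i j hij => by simpa using hij) (fun k => ?_) hf
    exact ⟨hlt k, by rw [hs]; exact hin k⟩
  · refine Set.infinite_of_injective_forall_mem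
      (f := fun k : ℕ => Ordinal.omega0 + (k : Ordinal.{w}))
      (fun i j hij => by simpa using hij) (fun k => ?_) hf
    exact ⟨hlt' k, by rw [hs']; exact hout k⟩

/-- Every set in a generically stable type meets each of its infinite Morley sequences. -/
theorem NoSplitting.exists_mem (hs : IsSaturated L M κ) (hκ : ℵ₀ < κ) {A₀ : Set M}
    (hA₀ : #A₀ < κ) (h : NoSplitting p A₀) (hC : #C < κ) (hp : Invariant p C) {a : ℕ → α → M}
    (ha : IsMorleySeq p C a) {X : Set (α → M)} (hX : Contains p X) : ∃ i, a i ∈ X := by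
  by_contra! hcon
  obtain ⟨k, e, S, -, hS, rfl⟩ := exists_eq_fib_empty hX.definable
  replace hS := hS.mono (Set.empty_subset C)
  have hCA : #(C ∪ A₀ : Set M) < κ := mk_union_lt hκ.le hC hA₀
  -- `NoSplitting` needs a base containing `A₀`, so the counterexample is moved to a sequence that
  -- is Morley over `C ∪ A₀`. All Morley sequences over `C` have the same type over `C`, and the
  -- parameters of `X` are carried along.
  obtain ⟨a', ha'⟩ := hs.exists_isMorleySeq hκ hCA p
  obtain ⟨e', he'⟩ := hs.exists_sameType_extension hκ hC
    (ha.sameType hp (ha'.mono Set.subset_union_left)) e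
  have hX' : Contains p (fib S e') := (hp.contains_iff hS he'.sum_left).1 hX
  have hout : ∀ i, a' i ∉ fib S e' := by
    intro i hi
    exact hcon i ((he'.seq_apply i).symm.of_mem hS hi)
  -- A continuation generic over the moved parameters as well lies entirely in the moved set, which
  -- `a'` avoids.
  obtain ⟨a'', ha''⟩ := hs.exists_isMorleySeq hκ (C := C ∪ A₀ ∪ entries a' ∪ Set.range e')
    (mk_union_lt hκ.le (mk_union_lt hκ.le hCA (mk_lt_of_countable hκ (countable_entries _)))
      (mk_lt_of_countable hκ (Set.countable_range _))) p
  refine h _ Set.subset_union_right a' a'' ha' (ha''.mono Set.subset_union_left) (fib S e')ᶜ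
    hX'.definable.compl ⟨hout, fun i hi => hi ?_⟩
  exact ((ha''.realizes i).mem_iff (definable_fib hS
    (fun m hm => Or.inl (Or.inl (Or.inl hm))) fun j => Or.inr ⟨j, rfl⟩)).2 hX'

/-- If the type of `c` over `C` did not force `fib S c` into `p`, compactness would give `c'` of the
same type with `fib S c'` disjoint from a fixed Morley sequence, against `NoSplitting.exists_mem`.
-/
theorem NoSplitting.not_split (hs : IsSaturated L M κ) (hκ : ℵ₀ < κ) {A₀ : Set M}
    (hA₀ : #A₀ < κ) (h : NoSplitting p A₀) (hC : #C < κ) (hp : Invariant p C)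
    {S : Set (α ⊕ β → M)} (hS : C.Definable L S) {c : β → M} (hc : Contains p (fib S c)) :
    ∃ X, C.Definable L X ∧ c ∈ X ∧ ∀ x ∈ X, Contains p (fib S x) := by
  by_contra! hcon
  obtain ⟨a, ha⟩ := hs.exists_isMorleySeq hκ hC p
  obtain ⟨c', hc'⟩ := hs.exists_mem_of_fip hκ (C := C ∪ entries a)
    (mk_union_lt hκ.le hC (mk_lt_of_countable hκ (countable_entries _)))
    (F := {X | C.Definable L X ∧ c ∈ X} ∪ Set.range fun i => {y | Sum.elim (a i) y ∉ S})
    (by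
      rintro X (hX | ⟨i, rfl⟩)
      · exact hX.1.mono Set.subset_union_left
      · have := definable_fib (C := C ∪ entries a)
          (hS.compl.preimage_comp (Sum.swap : α ⊕ β → β ⊕ α)) Set.subset_union_left
          (b := a i) fun j => Or.inr ⟨i, j, rfl⟩
        convert this using 1
        ext y
        simp only [Set.mem_ofPred_eq, mem_fib, Set.mem_preimage, Set.mem_compl_iff]
        rw [show Sum.elim y (a i) ∘ Sum.swap = Sum.elim (a i) y by
          funext j; rcases j with j | j <;> rfl])
    (by
      intro F₀ hF₀ hfin
      obtain ⟨x, hx, hxS⟩ := hcon (⋂₀ (F₀ ∩ {X | C.Definable L X ∧ c ∈ X}))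
        (definable_sInter (hfin.subset Set.inter_subset_left) fun X hX => hX.2.1)
        (fun X hX => hX.2.2)
      -- A Morley sequence over `C` and `x` avoids `fib S x`; carrying it to the fixed sequence `a`
      -- takes `x` to the required `x'`.
      obtain ⟨a', ha'⟩ := hs.exists_isMorleySeq hκ (C := C ∪ Set.range x)
        (mk_union_lt hκ.le hC (mk_lt_of_countable hκ (Set.countable_range _))) p
      obtain ⟨x', hx'⟩ := hs.exists_sameType_extension hκ hC
        ((ha'.mono Set.subset_union_left).sameType hp ha) x
      refine ⟨x', fun X hX => ?_⟩
      rcases hF₀ hX with hX' | ⟨i, rfl⟩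
      · exact hx'.sum_left.of_mem hX'.1 (hx X ⟨hX, hX'⟩)
      · intro hi
        have h2 : Sum.elim (a' i) x ∈ S := (hx'.seq_apply i).symm.of_mem hS hi
        exact hxS (((ha'.realizes i).mem_iff (definable_fib hS Set.subset_union_left
          fun j => Or.inr ⟨j, rfl⟩)).1 h2))
  have hcc : SameType L C c c' := sameType_iff.2 fun X hX => ⟨fun h => hc' X (Or.inl ⟨hX, h⟩),
    fun h => by_contra fun h' => hc' Xᶜ (Or.inl ⟨hX.compl, h'⟩) h⟩
  obtain ⟨i, hi⟩ := h.exists_mem hs hκ hA₀ hC hp ha ((hp.contains_iff hS hcc).1 hc)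
  exact hc' _ (Or.inr ⟨i, rfl⟩) hi

/-- Generically stable types are definable. -/
theorem NoSplitting.definable (hs : IsSaturated L M κ) (hκ : ℵ₀ < κ) {A₀ : Set M}
    (hA₀ : #A₀ < κ) (h : NoSplitting p A₀) (hC : #C < κ) (hp : Invariant p C)
    {S : Set (α ⊕ β → M)} (hS : C.Definable L S) :
    C.Definable L {c : β → M | Contains p (fib S c)} := by
  by_contra hcon
  have hu : ∀ c : β → M, (Set.univ : Set M).Definable L (fib S c) := fun c =>
    definable_fib hS (Set.subset_univ _) fun _ => trivial
  obtain ⟨c, hc⟩ := hs.exists_split hκ hC hcon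
  by_cases hcS : Contains p (fib S c)
  · obtain ⟨X, hX, hcX, hX'⟩ := h.not_split hs hκ hA₀ hC hp hS hcS
    obtain ⟨-, x, hx, hxD⟩ := hc X hX hcX
    exact hxD (hX' x hx)
  · rw [← contains_compl (hu c), ← fib_compl] at hcS
    obtain ⟨X, hX, hcX, hX'⟩ := h.not_split hs hκ hA₀ hC hp hS.compl hcS
    obtain ⟨⟨x, hx, hxD⟩, -⟩ := hc X hX hcX
    have := hX' x hx
    rw [fib_compl, contains_compl (hu x)] at this
    exact this hxD

/-- The types `p` and `q` commute over all small sets containing `A`. -/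
def Commute {α β : Type} (κ : Cardinal.{w}) (A : Set M) (p : GlobalType L M α)
    (q : GlobalType L M β) : Prop :=
  ∀ C : Set M, A ⊆ C → #C < κ → ∀ a b, Realizes p C a → Realizes q (C ∪ Set.range a) b →
    Realizes p (C ∪ Set.range b) a

/-- If order mattered, some `S` would fail at `(a, b)` although `fib S b` belongs to `p`. In a
Morley sequence of length `ω + ω`, with `c' 0` at place `ω`, the set `fib S (c' 0)` then misses all
earlier terms and contains all later ones. -/
theorem NoSplitting.commute_self (hs : IsSaturated L M κ) (hκ : ℵ₀ < κ) {A₀ : Set M}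
    (hA₀ : #A₀ < κ) (h : NoSplitting p A₀) (hp : Invariant p A) : Commute κ A p p := by
  intro C hAC hC a b ha hb
  replace hp := hp.mono hAC
  refine realizes_iff.2 fun X hX hpX => ?_
  obtain ⟨S, hS, rfl⟩ := exists_eq_fib hX
  by_contra haX
  have hCA : #(C ∪ A₀ : Set M) < κ := mk_union_lt hκ.le hC hA₀
  obtain ⟨c, hc⟩ := hs.exists_isMorleySeq hκ hCA p
  obtain ⟨c', hc'⟩ := hs.exists_isMorleySeq hκ (C := C ∪ A₀ ∪ entries c)
    (mk_union_lt hκ.le hCA (mk_lt_of_countable hκ (countable_entries _))) p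
  have hCsub : C ⊆ C ∪ A₀ ∪ entries c := fun m hm => Or.inl (Or.inl hm)
  have hX' : Contains p (fib S (c' 0)) := (hp.contains_iff hS
    ((hb.mono Set.subset_union_left).sameType ((hc'.realizes 0).mono hCsub))).1 hpX
  refine h _ Set.subset_union_right c (fun i => c' (i + 1)) hc
    (hc'.tail.mono Set.subset_union_left) (fib S (c' 0))ᶜ hX'.definable.compl
    ⟨fun i hi => haX ?_, fun i hi => hi ?_⟩
  · have h1 : SameType L C (Sum.elim b a) (Sum.elim (c' 0) (c i)) :=
      hp.sameType_sumElim (ha.sameType ((hc.realizes i).mono Set.subset_union_left)) hb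
        ((hc'.realizes 0).mono (Set.union_subset hCsub
          (by rintro _ ⟨k, rfl⟩; exact Or.inr ⟨i, k, rfl⟩)))
    exact h1.sum_swap.symm.of_mem hS hi
  · exact ((hc'.tail.realizes i).mem_iff (definable_fib hS
      (hCsub.trans Set.subset_union_left) fun j => Or.inr ⟨j, rfl⟩)).2 hX'

/-- Replace `(a, b)` by a pair of the same type over `C` that is generic over the parameters of a
box deciding `S`. The pair lies in the box and outside `S`, yet `fib S b'` is in `p` and meets the
side `P`, so `S` is not constant on the box. -/
theorem Orthogonal.commute (hs : IsSaturated L M κ) (hκ : ℵ₀ < κ) (h : Orthogonal p q)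
    (hp : Invariant p A) (hq : Invariant q A) : Commute κ A p q := by
  intro C hAC hC a b ha hb
  replace hp := hp.mono hAC
  replace hq := hq.mono hAC
  refine realizes_iff.2 fun X hX hpX => ?_
  obtain ⟨S, hS, rfl⟩ := exists_eq_fib hX
  by_contra haX
  obtain ⟨P, Q, hP, hQ, hPQ⟩ := h.exists_box (hS.mono (Set.subset_univ _))
  obtain ⟨F, -, hF⟩ := Set.definable_iff_finitely_definable.1 hP.definable
  obtain ⟨G, -, hG⟩ := Set.definable_iff_finitely_definable.1 hQ.definable
  have hC' : #(C ∪ (F ∪ G) : Set M) < κ := mk_union_lt hκ.le hC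
    (mk_lt_of_countable hκ (F.countable_toSet.union G.countable_toSet))
  obtain ⟨a', ha'⟩ := hs.exists_realizes hκ hC' p
  obtain ⟨b', hb'⟩ := hs.exists_realizes hκ (C := C ∪ (F ∪ G) ∪ Set.range a')
    (mk_union_lt hκ.le hC' (mk_lt_of_countable hκ (Set.countable_range _))) q
  have haP : a' ∈ P := realizes_iff.1 ha' P (hF.mono fun m hm => Or.inr (Or.inl hm)) hP
  have hbQ : b' ∈ Q := realizes_iff.1 hb' Q
    (hG.mono fun m hm => Or.inl (Or.inr (Or.inr hm))) hQ
  have h1 : SameType L C (Sum.elim b a) (Sum.elim b' a') :=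
    hq.sameType_sumElim (ha.sameType (ha'.mono Set.subset_union_left)) hb
      (hb'.mono (Set.union_subset_union_left _ Set.subset_union_left))
  have h2 : Sum.elim a' b' ∉ S := fun hi => haX (h1.sum_swap.symm.of_mem hS hi)
  have h3 : Contains p (fib S b') := (hp.contains_iff hS h1.sum_left).1 hpX
  obtain ⟨x, hxS, hxP⟩ := (h3.inter hP).nonempty
  rcases hPQ with hPQ | hPQ
  · exact h2 (hPQ a' haP b' hbQ)
  · exact hPQ x hxP b' hbQ hxS

end GenericStability

end GenStab

namespace GenStab

/-! ### Weak orthogonality and preservation of non-isolation. -/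

section WeakOrthogonality

variable {L : FirstOrder.Language.{u, v}} {M : Type w} [L.Structure M] {A C : Set M}
variable {κ : Cardinal.{w}} {α β : Type} [Finite α] [Finite β]

/-- Orthogonal types, the first of which is generically stable and regular over `A`, are weakly
orthogonal over every small set containing `A`. -/
theorem RegularOver.realizes_union_of_orthogonal {n : ℕ} {p : GlobalType L M (Fin n)}
    {q : GlobalType L M β} (hreg : RegularOver κ p A) (hs : IsSaturated L M κ) (hκ : ℵ₀ < κ)
    {A₀ : Set M} (hA₀ : #A₀ < κ) (hp₀ : NoSplitting p A₀) (hq : Invariant q A)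
    (hpq : Commute κ A p q) (hqq : Commute κ A q q) (horth : Orthogonal p q)
    (hAC : A ⊆ C) (hC : #C < κ) {a : Fin n → M} {b : β → M} (ha : Realizes p C a)
    (hb : Realizes q C b) : Realizes p (C ∪ Set.range b) a := by
  have hp := hreg.2.1.mono hAC
  replace hq := hq.mono hAC
  refine realizes_iff.2 fun X hX hpX => ?_
  obtain ⟨S, hS, rfl⟩ := exists_eq_fib hX
  by_contra haX
  obtain ⟨P, Q, hP, hQ, hPQ⟩ := horth.exists_box (hS.mono (Set.subset_univ _))
  obtain ⟨G, -, hG⟩ := Set.definable_iff_finitely_definable.1 hQ.definable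
  -- Generic over the parameters of `Q`, so every `c i` lies in `Q`. The plan is to find a Morley
  -- sequence `a'` in `p` with `(a' i, c i)` outside `S`; it must meet `P`, a contradiction.
  obtain ⟨c, hc⟩ := hs.exists_isMorleySeq hκ (C := C ∪ G) (mk_union_lt hκ.le hC
    (mk_lt_of_countable hκ G.countable_toSet)) q
  have hcQ : ∀ i, c i ∈ Q := fun i =>
    realizes_iff.1 (hc.realizes i) Q (hG.mono Set.subset_union_right) hQ
  replace hc := hc.mono Set.subset_union_left
  have hcS : ∀ i, Contains p (fib S (c i)) := fun i =>
    (hp.contains_iff hS (hb.sameType (hc.realizes i))).1 hpX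
  replace hPQ : ∀ x ∈ P, ∀ y ∈ Q, Sum.elim x y ∈ S := by
    rcases hPQ with h | h
    · exact h
    · obtain ⟨x, hxS, hxP⟩ := ((hcS 0).inter hP).nonempty
      exact absurd hxS (h x hxP _ (hcQ 0))
  obtain ⟨d, hd⟩ := hs.exists_isMorleySeq hκ (C := C ∪ Set.range a ∪ Set.range b)
    (mk_union_lt hκ.le (mk_union_lt hκ.le hC (mk_lt_of_countable hκ (Set.countable_range _)))
      (mk_lt_of_countable hκ (Set.countable_range _))) q
  have hinit : ∀ i, #(C ∪ initial d i : Set M) < κ := fun i =>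
    mk_union_lt hκ.le hC (mk_lt_of_countable hκ (countable_initial _ _))
  -- Since `d` is generic over both `a` and `b`, commutation keeps each of them separately generic
  -- over `d`.
  have hind : ∀ i, Realizes p (C ∪ initial d i) a ∧ Realizes q (C ∪ initial d i) b := by
    intro i
    induction i with
    | zero => simpa using And.intro ha hb
    | succ i ih =>
      rw [initial_succ, ← Set.union_assoc]
      refine ⟨hpq _ (hAC.trans Set.subset_union_left) (hinit i) _ _ ih.1 ((hd i).mono ?_),
        hqq _ (hAC.trans Set.subset_union_left) (hinit i) _ _ ih.2 ((hd i).mono ?_)⟩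
      · rintro m ((hm | hm) | hm)
        exacts [Or.inl (Or.inl (Or.inl hm)), Or.inr hm, Or.inl (Or.inl (Or.inr hm))]
      · rintro m ((hm | hm) | hm)
        exacts [Or.inl (Or.inl (Or.inl hm)), Or.inr hm, Or.inl (Or.inr hm)]
  -- The tuples `d j`, `j < i`, followed by `b` have the type of `c j`, `j < i`, followed by `c i`;
  -- the image of `a` under this correspondence is `a' i`.
  have hex : ∀ i, ∃ a', SameType L C (Sum.elim a b) (Sum.elim a' (c i)) ∧
      Realizes p (C ∪ initial c i) a' := by
    intro i
    have h1 := (hd.mono (A := C) (fun m hm => Or.inl (Or.inl hm))).sameType_initial hq hc i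
    have h2 := (hind i).2
    have h3 := hc i
    have h4 := (hind i).1
    rw [initial_eq_range] at h2 h3 h4 ⊢
    obtain ⟨a', ha'⟩ := hs.exists_sameType_extension hκ hC (hq.sameType_sumElim h1 h2 h3) a
    refine ⟨a', ?_, hp.realizes_of_sameType ?_ h4⟩
    · have := ha'.comp (Sum.map id Sum.inl)
      simpa only [Sum.elim_comp_map, Function.comp_id, Sum.elim_comp_inl] using this
    · have := ha'.comp (Sum.map id Sum.inr)
      simpa only [Sum.elim_comp_map, Function.comp_id, Sum.elim_comp_inr] using this
  choose a' hab ha' using hex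
  have hnot : ∀ i, Sum.elim (a' i) (c i) ∉ S := fun i hi => haX ((hab i).symm.of_mem hS hi)
  -- For `j < i`, the tuple `a' j` is not generic over a base containing `c j`, because it lies
  -- outside `fib S (c j)`. By regularity, adjoining it does not affect the genericity of `a' i`.
  have hmor : ∀ i, ∀ j ≤ i, Realizes p (C ∪ initial c i ∪ initial a' j) (a' i) := by
    intro i j
    induction j with
    | zero => simpa using ha' i
    | succ j ih =>
      intro hj
      rw [initial_succ, ← Set.union_assoc]
      rcases hreg.2.2 (C ∪ initial c i ∪ initial a' j)
        (fun m hm => Or.inl (Or.inl (hAC hm)))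
        (mk_union_lt hκ.le (mk_union_lt hκ.le hC (mk_lt_of_countable hκ (countable_initial _ _)))
          (mk_lt_of_countable hκ (countable_initial _ _)))
        (a' j) ((ha' j).mono (hAC.trans Set.subset_union_left)) with h | h
      · refine absurd ((h.mem_iff (definable_fib hS (fun m hm => Or.inl (Or.inl hm))
          (b := c j) ?_)).2 (hcS j)) (hnot j)
        exact fun k => Or.inl (Or.inr ⟨j, hj, k, rfl⟩)
      · exact h _ (ih (Nat.le_of_succ_le hj))
  obtain ⟨i, hi⟩ := hp₀.exists_mem hs hκ hA₀ hC hp (a := a')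
    (fun i => (hmor i i le_rfl).mono (Set.union_subset_union_left _ Set.subset_union_left)) hP
  exact hnot i (hPQ _ hi _ (hcQ i))

/-- If `q` is generically stable and commutes with `p`, then adding a realization of `q` does not
isolate `p`. -/
theorem NoSplitting.exists_isolating {p : GlobalType L M α} {q : GlobalType L M β}
    (hs : IsSaturated L M κ) (hκ : ℵ₀ < κ) {A₀ : Set M} (hA₀ : #A₀ < κ) (hq₀ : NoSplitting q A₀)
    (hq : Invariant q A) (hqp : Commute κ A q p) (hAC : A ⊆ C) (hC : #C < κ) {b : β → M}
    (hb : Realizes q C b) {Y : Set (α → M)} (hY : (C ∪ Set.range b).Definable L Y)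
    (hne : Y.Nonempty) (hYp : ∀ y ∈ Y, Realizes p (C ∪ Set.range b) y) :
    ∃ Z : Set (α → M), C.Definable L Z ∧ Z.Nonempty ∧ ∀ z ∈ Z, Realizes p C z := by
  obtain ⟨T, hT, rfl⟩ := exists_eq_fib hY
  have hT' := hT.preimage_comp (Sum.swap : α ⊕ β → β ⊕ α)
  have hswap : ∀ (x : α → M) (y : β → M), y ∈ fib ((fun g : β ⊕ α → M =>
      g ∘ (Sum.swap : α ⊕ β → β ⊕ α)) ⁻¹' T) x ↔ Sum.elim x y ∈ T := by
    intro x y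
    rw [mem_fib, Set.mem_preimage, Sum.elim_swap]
  -- `Z` consists of the `x` for which `T(x, y)` belongs to `q(y)`. Any `y ∈ Y` lies in it, since
  -- `b` is still generic over `y` by commutation.
  refine ⟨_, hq₀.definable hs hκ hA₀ hC (hq.mono hAC) hT', ?_, ?_⟩
  · obtain ⟨a, ha⟩ := hne
    refine ⟨a, ?_⟩
    exact ((hqp C hAC hC b a hb (hYp a ha)).mem_iff (definable_fib hT' Set.subset_union_left
      fun j => Or.inr ⟨j, rfl⟩)).1 ((hswap a b).2 ha)
  · intro a ha
    obtain ⟨b', hb'⟩ := hs.exists_realizes hκ (C := C ∪ Set.range a)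
      (mk_union_lt hκ.le hC (mk_lt_of_countable hκ (Set.countable_range _))) q
    have hab : Sum.elim a b' ∈ T := (hswap a b').1 ((hb'.mem_iff (definable_fib hT'
      Set.subset_union_left fun j => Or.inr ⟨j, rfl⟩)).2 ha)
    refine realizes_iff.2 fun P hP hpP => ?_
    -- That `T(x, y)` implies `P(x)` for all `x` is a condition on `y` over `C`, so it passes from
    -- `b` to `b'`.
    have hd : C.Definable L {y : β → M | ∀ x : α → M, Sum.elim y x ∈
        ((fun g : β ⊕ α → M => g ∘ (Sum.swap : α ⊕ β → β ⊕ α)) ⁻¹' T)ᶜ ∪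
          (fun g : β ⊕ α → M => g ∘ Sum.inr) ⁻¹' P} :=
      (hT'.compl.union (hP.preimage_comp Sum.inr)).forall_of_finite
    have h1 := (hb.sameType (hb'.mono Set.subset_union_left)).of_mem hd (fun x => by
      by_cases hx : Sum.elim x b ∈ T
      · exact Or.inr (realizes_iff.1 (hYp x hx) P (hP.mono Set.subset_union_left) hpP)
      · left
        rwa [Set.mem_compl_iff, Set.mem_preimage, Sum.elim_swap])
    rcases h1 a with h | h
    · rw [Set.mem_compl_iff, Set.mem_preimage, Sum.elim_swap] at h
      exact absurd hab h
    · exact h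

end WeakOrthogonality

/-! ### Exchange and invariance of dimension. -/

section Dimension

variable {L : FirstOrder.Language.{u, v}} {M : Type w} [L.Structure M] {A B : Set M}
variable {κ : Cardinal.{w}} {n : ℕ} {p : GlobalType L M (Fin n)}

/-- Finite Morley sequences. -/
def IsMorleyList (p : GlobalType L M (Fin n)) : Set M → List (Fin n → M) → Prop
  | _, [] => True
  | B, c :: l => Realizes p B c ∧ IsMorleyList p (B ∪ Set.range c) l

theorem IsMorleyList.mono {l : List (Fin n → M)} : ∀ {A B : Set M}, IsMorleyList p B l → A ⊆ B →
    IsMorleyList p A l := by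
  induction l with
  | nil => exact fun _ _ => trivial
  | cons c l ih =>
    exact fun h hAB => ⟨h.1.mono hAB, ih h.2 (Set.union_subset_union_left _ hAB)⟩

/-- Failure of `a` to be generic persists over larger sets, so regularity lets `a` be adjoined to
the base at every step. -/
theorem RegularOver.isMorleyList_union (hreg : RegularOver κ p A) (hκ : ℵ₀ < κ) {a : Fin n → M}
    (ha : Realizes p A a) {l : List (Fin n → M)} : ∀ {B : Set M}, A ⊆ B → #B < κ →
    ¬ Realizes p B a → IsMorleyList p B l → IsMorleyList p (B ∪ Set.range a) l := by
  induction l with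
  | nil => exact fun _ _ _ _ => trivial
  | cons c l ih =>
    intro B hAB hB hn h
    refine ⟨(hreg.2.2 B hAB hB a ha).resolve_left hn c h.1, ?_⟩
    rw [Set.union_right_comm]
    exact ih (hAB.trans Set.subset_union_left)
      (mk_union_lt hκ.le hB (mk_lt_of_countable hκ (Set.countable_range _)))
      (fun h' => hn (h'.mono Set.subset_union_left)) h.2

/-- Adjoining `a` costs at most one term. At the first term `c` that stops being generic, symmetry
shows that `a` is not generic over the base with `c`, so `RegularOver.isMorleyList_union` keeps all
later terms. -/
theorem RegularOver.exchange (hreg : RegularOver κ p A) (hκ : ℵ₀ < κ) (hcomm : Commute κ A p p)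
    {a : Fin n → M} (ha : Realizes p A a) {l : List (Fin n → M)} : ∀ {B : Set M}, A ⊆ B → #B < κ →
    IsMorleyList p B l → ∃ l', IsMorleyList p (B ∪ Set.range a) l' ∧ l' ⊆ l ∧
      l.length ≤ l'.length + 1 := by
  induction l with
  | nil => exact fun _ _ _ => ⟨[], trivial, List.Subset.refl _, by simp⟩
  | cons c l ih =>
    intro B hAB hB h
    have hB' : #(B ∪ Set.range c : Set M) < κ :=
      mk_union_lt hκ.le hB (mk_lt_of_countable hκ (Set.countable_range _))
    by_cases hc : Realizes p (B ∪ Set.range a) c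
    · obtain ⟨l', h1, h2, h3⟩ := ih (hAB.trans Set.subset_union_left) hB' h.2
      refine ⟨c :: l', ⟨hc, ?_⟩, List.cons_subset_cons c h2, by simpa using h3⟩
      rwa [Set.union_right_comm]
    · refine ⟨l, ?_, List.subset_cons_self c l, by simp⟩
      exact (hreg.isMorleyList_union hκ ha (hAB.trans Set.subset_union_left) hB'
        (fun h' => hc (hcomm B hAB hB c a h.1 h')) h.2).mono
        (Set.union_subset_union_left _ Set.subset_union_left)

/-- Each member of `s` removes at most one term of `l`, and after all are adjoined no term can
survive. -/
theorem RegularOver.length_le (hreg : RegularOver κ p A) (hκ : ℵ₀ < κ) (hcomm : Commute κ A p p)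
    {s : List (Fin n → M)} : ∀ {B : Set M} {l : List (Fin n → M)}, A ⊆ B → #B < κ →
    (∀ a ∈ s, Realizes p A a) → IsMorleyList p B l →
    (∀ c ∈ l, ¬ Realizes p (B ∪ {m | ∃ a ∈ s, ∃ k, m = a k}) c) → l.length ≤ s.length := by
  induction s with
  | nil =>
    intro B l hAB hB hs hl hn
    cases l with
    | nil => simp
    | cons c l => exact absurd hl.1 (by simpa using hn c (by simp))
  | cons a s ih =>
    intro B l hAB hB hs hl hn
    obtain ⟨l', h1, h2, h3⟩ := hreg.exchange hκ hcomm (hs a (by simp)) hAB hB hl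
    have h4 := ih (hAB.trans Set.subset_union_left)
      (mk_union_lt hκ.le hB (mk_lt_of_countable hκ (Set.countable_range a)))
      (fun a' ha' => hs a' (List.mem_cons_of_mem _ ha')) h1 (fun c hc h => hn c (h2 hc) (h.mono ?_))
    · rw [List.length_cons]
      omega
    · rintro m (hm | ⟨a', ha', k, rfl⟩)
      · exact Or.inl (Or.inl hm)
      · rcases List.mem_cons.1 ha' with rfl | ha'
        · exact Or.inl (Or.inr ⟨k, rfl⟩)
        · exact Or.inr ⟨a', ha', k, rfl⟩

theorem IsMorley.isMorleyList {α : Ordinal.{w}} {s : Ordinal.{w} → Fin n → M}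
    (h : IsMorley p A α s) (k : ℕ) : ∀ j : ℕ, ((j + k : ℕ) : Ordinal.{w}) ≤ α →
    IsMorleyList p (below A s j) ((List.range' j k).map fun i : ℕ => s i) := by
  induction k with
  | zero => exact fun _ _ => trivial
  | succ k ih =>
    intro j hj
    refine ⟨h j (lt_of_lt_of_le (by exact_mod_cast (by omega)) hj), ?_⟩
    refine (ih (j + 1) (by rwa [Nat.add_right_comm])).mono ?_
    rintro m ((hm | ⟨i, hi, l, rfl⟩) | ⟨l, rfl⟩)
    · exact Or.inl hm
    · exact Or.inr ⟨i, hi.trans (by exact_mod_cast Nat.lt_succ_self j), l, rfl⟩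
    · exact Or.inr ⟨j, by exact_mod_cast Nat.lt_succ_self j, l, rfl⟩

theorem RegularOver.le_of_isMaximalMorleyIn (hreg : RegularOver κ p A) (hκ : ℵ₀ < κ)
    (hA : #A < κ) (hcomm : Commute κ A p p) {N : Set M} {k l : ℕ} {α : Ordinal.{w}}
    {s t : Ordinal.{w} → Fin n → M} (hs : IsMaximalMorleyIn p A N k s) (ht : IsMorley p A α t)
    (htN : ∀ i < α, ∀ j, t i j ∈ N) (hl : (l : Ordinal.{w}) ≤ α) : l ≤ k := by
  have h1 := ht.isMorleyList l 0 (by simpa using hl)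
  have h2 := hreg.length_le hκ hcomm (s := (List.range' 0 k).map fun i : ℕ => s i) subset_rfl hA
    (fun a ha => ?_) (h1.mono (A := A) Set.subset_union_left) (fun c hc h => ?_)
  · simpa using h2
  · obtain ⟨i, hi, rfl⟩ := List.mem_map.1 ha
    refine (hs.1 i ?_).mono Set.subset_union_left
    have : i < k := by simpa using hi
    exact_mod_cast this
  · obtain ⟨i, hi, rfl⟩ := List.mem_map.1 hc
    have hi' : i < l := by simpa using hi
    refine hs.2.2 ⟨t i, htN i (lt_of_lt_of_le (by exact_mod_cast hi') hl), h.mono ?_⟩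
    rintro m (hm | ⟨j, hj, x, rfl⟩)
    · exact Or.inl hm
    · obtain ⟨j, rfl⟩ := Ordinal.lt_omega0.1 (hj.trans (Ordinal.natCast_lt_omega0 k))
      have hj' : j < k := by exact_mod_cast hj
      exact Or.inr ⟨s j, List.mem_map.2 ⟨j, by simpa using hj', rfl⟩, x, rfl⟩

theorem RegularOver.hasDim (hreg : RegularOver κ p A) (hκ : ℵ₀ < κ)
    (hA : #A < κ) (hcomm : Commute κ A p p) {N : Set M} {k : ℕ} {s : Ordinal.{w} → Fin n → M}
    (hs : IsMaximalMorleyIn p A N k s) : HasDim p N A k := by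
  refine ⟨⟨_, s, hs⟩, fun α t ht => ?_⟩
  have h1 : α < ((k + 1 : ℕ) : Ordinal.{w}) := by
    by_contra! h
    have := hreg.le_of_isMaximalMorleyIn hκ hA hcomm hs ht.1 ht.2.1 h
    omega
  obtain ⟨l, rfl⟩ := Ordinal.lt_omega0.1 (h1.trans (Ordinal.natCast_lt_omega0 _))
  have h2 : l < k + 1 := by exact_mod_cast h1
  have h3 := hreg.le_of_isMaximalMorleyIn hκ hA hcomm ht hs.1 hs.2.1 le_rfl
  rw [Ordinal.card_nat, show l = k by omega]

end Dimension

end GenStab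

namespace GenStab

/-! ### Omitting types inside a saturated structure. -/

section OmittingTypes

variable {L : FirstOrder.Language.{u, v}} {M : Type w} [L.Structure M] {B : Set M}
variable {κ : Cardinal.{w}}

/-- Shrinking a nonempty definable set of sequences so that the sequences in it contain a witness
for a given formula. -/
theorem exists_subset_witness {X : Set (ℕ → M)} (hX : B.Definable L X) (hne : X.Nonempty)
    {T : Set (Fin 1 ⊕ ℕ → M)} (hT : B.Definable L T) :
    ∃ X' ⊆ X, B.Definable L X' ∧ X'.Nonempty ∧ ∃ k : ℕ, ∀ x ∈ X', (fib T x).Nonempty →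
      (fun _ => x k) ∈ fib T x := by
  classical
  obtain ⟨F, X₀, hX₀, hXF⟩ := exists_finite_support hX
  obtain ⟨G, T₀, hT₀, hTG⟩ := exists_finite_support hT
  -- A variable on which neither `X` nor `T` depends can be reset to a witness freely.
  obtain ⟨k, hk⟩ := Infinite.exists_notMem_finset (F ∪ G.toRight)
  have hkF : k ∉ F := fun h => hk (Finset.mem_union_left _ h)
  have hkG : Sum.inr k ∉ G := fun h => hk (Finset.mem_union_right _ (by simpa using h))
  refine ⟨X ∩ ({x | ∃ u : Fin 1 → M, Sum.elim x u ∈ (fun g : ℕ ⊕ Fin 1 → M =>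
      g ∘ (Sum.swap : Fin 1 ⊕ ℕ → ℕ ⊕ Fin 1)) ⁻¹' T}ᶜ ∪
      (fun x : ℕ → M => x ∘ (Sum.elim (fun _ => k) id : Fin 1 ⊕ ℕ → ℕ)) ⁻¹' T),
    Set.inter_subset_left, hX.inter (((hT.preimage_comp _).exists_of_finite).compl.union
      (hT.preimage_comp _)), ?_, k, ?_⟩
  · obtain ⟨x, hx⟩ := hne
    by_cases h : ∃ u : Fin 1 → M, Sum.elim x u ∈ (fun g : ℕ ⊕ Fin 1 → M =>
      g ∘ (Sum.swap : Fin 1 ⊕ ℕ → ℕ ⊕ Fin 1)) ⁻¹' T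
    · obtain ⟨u, hu⟩ := h
      refine ⟨Function.update x k (u 0), ?_, Or.inr ?_⟩
      · rw [hXF, Set.mem_ofPred_eq] at hx ⊢
        convert hx using 1
        funext i
        exact Function.update_of_ne (fun h : (i : ℕ) = k => hkF (h ▸ i.2)) _ _
      · rw [Set.mem_preimage, hTG, Set.mem_ofPred_eq] at hu ⊢
        convert hu using 1
        funext i
        obtain ⟨i | i, hi⟩ := i
        · simp [Subsingleton.elim i 0]
        · exact Function.update_of_ne (fun h : i = k => hkG (h ▸ hi)) _ _
    · exact ⟨x, hx, Or.inl h⟩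
  · rintro x ⟨-, hx | hx⟩ ⟨u, hu⟩
    · refine absurd ⟨u, ?_⟩ hx
      rwa [Set.mem_preimage, Sum.elim_swap]
    · rw [mem_fib]
      rwa [Set.mem_preimage, Sum.comp_elim] at hx

/-- The omitting types theorem inside a saturated structure: countably many sets of formulas over
a countable set `B`, none of which is isolated by a formula over `B`, are omitted in some countable
elementary substructure containing `B`. -/
theorem IsSaturated.exists_omitting [Countable L.Symbols] [Nonempty M] (hs : IsSaturated L M κ)
    (hκ : ℵ₀ < κ) (hB : B.Countable) {I : Type*} [Countable I] (n : I → ℕ)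
    (Φ : ∀ i, Set (Set (Fin (n i) → M))) (hΦ : ∀ i, ∀ P ∈ Φ i, B.Definable L P)
    (hloc : ∀ i Y, B.Definable L Y → Y.Nonempty → ∃ P ∈ Φ i, ¬ Y ⊆ P) :
    ∃ N : L.ElementarySubstructure M, (N : Set M).Countable ∧ B ⊆ (N : Set M) ∧
      ∀ i, ∀ a : Fin (n i) → M, (∀ k, a k ∈ N) → ∃ P ∈ Φ i, a ∉ P := by
  have : Countable B := hB.to_subtype
  -- The countably many requirements: a Henkin witness for each formula, and omission of `Φ i` by
  -- each finite subtuple of the sequence.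
  let R := L[[B]].Formula (Fin 1 ⊕ ℕ) ⊕ Σ i, (Fin (n i) → ℕ)
  let Sat : R → Set (ℕ → M) → Prop := fun r X => match r with
    | Sum.inl φ => ∃ k : ℕ, ∀ x ∈ X, (fib {v | φ.Realize v} x).Nonempty →
        (fun _ => x k) ∈ fib {v | φ.Realize v} x
    | Sum.inr ⟨i, k⟩ => ∃ P ∈ Φ i, ∀ x ∈ X, x ∘ k ∉ P
  have hstep : ∀ (r : R) (X : Set (ℕ → M)), B.Definable L X ∧ X.Nonempty →
      ∃ X', (B.Definable L X' ∧ X'.Nonempty) ∧ X' ⊆ X ∧ Sat r X' := by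
    rintro (φ | ⟨i, k⟩) X ⟨hX, hne⟩
    · obtain ⟨X', h1, h2, h3, h4⟩ := exists_subset_witness hX hne (T := {v | φ.Realize v}) ⟨φ, rfl⟩
      exact ⟨X', ⟨h2, h3⟩, h1, h4⟩
    · obtain ⟨P, hP, h⟩ := hloc i _ (definable_proj hX k) (hne.image _)
      obtain ⟨_, ⟨x, hx, rfl⟩, hxP⟩ := Set.not_subset.1 h
      exact ⟨X ∩ (fun x : ℕ → M => x ∘ k) ⁻¹' Pᶜ,
        ⟨hX.inter ((hΦ i P hP).compl.preimage_comp k), ⟨x, hx, hxP⟩⟩, Set.inter_subset_left,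
        P, hP, fun x hx => hx.2⟩
  have : Nonempty R := ⟨Sum.inl ⊥⟩
  obtain ⟨e, he⟩ := exists_surjective_nat R
  choose! next hnext hsub hsat using hstep
  let X : ℕ → Set (ℕ → M) := fun k => Nat.rec Set.univ (fun k X => next (e k) X) k
  have hX : ∀ k, B.Definable L (X k) ∧ (X k).Nonempty := by
    intro k
    induction k with
    | zero => exact ⟨Set.definable_univ, Set.univ_nonempty⟩
    | succ k ih => exact hnext _ _ ih
  have hanti : Antitone X := antitone_nat_of_succ_le fun k => hsub _ _ (hX k)
  obtain ⟨x, hx⟩ := hs.exists_mem hκ (mk_lt_of_countable hκ hB) (F := Set.range X)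
    (Set.range_nonempty X) (by rintro _ ⟨k, rfl⟩; exact (hX k).1)
    (by
      rintro _ ⟨k, rfl⟩ _ ⟨l, rfl⟩
      rcases le_total k l with h | h
      · exact ⟨l, (Set.inter_eq_right.2 (hanti h)).symm⟩
      · exact ⟨k, (Set.inter_eq_left.2 (hanti h)).symm⟩)
    (by rintro _ ⟨k, rfl⟩; exact (hX k).2)
  have hreq : ∀ r : R, ∃ Y, x ∈ Y ∧ Sat r Y := by
    intro r
    obtain ⟨k, rfl⟩ := he r
    exact ⟨X (k + 1), hx _ ⟨k + 1, rfl⟩, hsat _ _ (hX k)⟩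
  have hwit : ∀ T : Set (Fin 1 ⊕ ℕ → M), B.Definable L T → (fib T x).Nonempty →
      ∃ k, (fun _ => x k) ∈ fib T x := by
    rintro T ⟨φ, rfl⟩ hne
    obtain ⟨Y, hxY, k, h⟩ := hreq (Sum.inl φ)
    exact ⟨k, h x hxY hne⟩
  -- The Henkin requirements give the Tarski–Vaught criterion, so the range of `x` is the model.
  have hmeets : L.MeetsDefinable (Set.range x) := by
    rintro D ⟨d, hd⟩ hD
    obtain ⟨T, hT, h⟩ := exists_eq_fib (C := B) (b := x)
      (Set.Definable.mono hD Set.subset_union_right)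
    obtain ⟨k, hk⟩ := hwit T hT (h ▸ ⟨fun _ => d, hd⟩)
    rw [← h] at hk
    exact ⟨x k, hk, k, rfl⟩
  have hN : (hmeets.toElementarySubstructure : Set M) = Set.range x := hmeets.closure_eq_self
  refine ⟨hmeets.toElementarySubstructure, ?_, ?_, fun i a ha => ?_⟩
  · rw [hN]
    exact Set.countable_range x
  · intro b hb
    rw [hN]
    obtain ⟨k, hk⟩ := hwit _ ((Set.Definable.singleton_of_mem L hb).preimage_comp Sum.inl)
      ⟨fun _ => b, rfl⟩
    exact ⟨k, hk⟩
  · have ha' : ∀ k, ∃ j, x j = a k := fun k => by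
      have : a k ∈ (hmeets.toElementarySubstructure : Set M) := ha k
      rwa [hN] at this
    choose k hk using ha'
    obtain ⟨Y, hxY, P, hP, h⟩ := hreq (Sum.inr ⟨i, k⟩)
    refine ⟨P, hP, ?_⟩
    rw [show a = x ∘ k from (funext hk).symm]
    exact h x hxY

end OmittingTypes

end GenStab

namespace GenStab

/-! ### Independent families of realizations. -/

section Independence

variable {L : FirstOrder.Language.{u, v}} {M : Type w} [L.Structure M] {A : Set M}
variable {κ : Cardinal.{w}} {J : Type*} {n : J → ℕ}

/-- The set `A` together with the entries of the tuples `b y`, `y ∈ F`. -/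
def adjoin (A : Set M) (b : ∀ x, Fin (n x) → M) (F : Set J) : Set M :=
  A ∪ {m | ∃ y ∈ F, ∃ k, b y k = m}

theorem subset_adjoin (b : ∀ x, Fin (n x) → M) (F : Set J) : A ⊆ adjoin A b F :=
  Set.subset_union_left

theorem adjoin_mono (b : ∀ x, Fin (n x) → M) {F G : Set J} (h : F ⊆ G) :
    adjoin A b F ⊆ adjoin A b G :=
  Set.union_subset_union_right _ fun _ ⟨y, hy, hk⟩ => ⟨y, h hy, hk⟩

theorem adjoin_insert (b : ∀ x, Fin (n x) → M) (x : J) (F : Set J) :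
    adjoin A b (insert x F) = adjoin A b F ∪ Set.range (b x) := by
  ext m
  constructor
  · rintro (hm | ⟨y, rfl | hy, k, rfl⟩)
    exacts [Or.inl (Or.inl hm), Or.inr ⟨k, rfl⟩, Or.inl (Or.inr ⟨y, hy, k, rfl⟩)]
  · rintro ((hm | ⟨y, hy, k, rfl⟩) | ⟨k, rfl⟩)
    exacts [Or.inl hm, Or.inr ⟨y, Or.inr hy, k, rfl⟩, Or.inr ⟨x, Or.inl rfl, k, rfl⟩]

theorem adjoin_empty (b : ∀ x, Fin (n x) → M) : adjoin A b ∅ = A := by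
  ext m
  simp [adjoin]

theorem countable_adjoin [Countable J] (hA : A.Countable) (b : ∀ x, Fin (n x) → M) (F : Set J) :
    (adjoin A b F).Countable := by
  refine hA.union ((Set.countable_range fun x : Σ y, Fin (n y) => b x.1 x.2).mono ?_)
  rintro _ ⟨y, -, k, rfl⟩
  exact ⟨⟨y, k⟩, rfl⟩

theorem exists_finset_subset_adjoin {b : ∀ x, Fin (n x) → M} {G : Set J} {E : Finset M}
    (hE : (E : Set M) ⊆ adjoin A b G) :
    ∃ F : Finset J, (F : Set J) ⊆ G ∧ (E : Set M) ⊆ adjoin A b F := by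
  classical
  induction E using Finset.induction_on with
  | empty => exact ⟨∅, by simp, by simp⟩
  | insert m E _ ih =>
    rw [Finset.coe_insert, Set.insert_subset_iff] at hE
    obtain ⟨F, hFG, hF⟩ := ih hE.2
    rcases hE.1 with hm | ⟨y, hy, k, rfl⟩
    · refine ⟨F, hFG, ?_⟩
      rw [Finset.coe_insert, Set.insert_subset_iff]
      exact ⟨Or.inl hm, hF⟩
    · refine ⟨insert y F, ?_, ?_⟩
      · rw [Finset.coe_insert, Set.insert_subset_iff]
        exact ⟨hy, hFG⟩
      · rw [Finset.coe_insert, Finset.coe_insert, Set.insert_subset_iff]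
        exact ⟨Or.inr ⟨y, Or.inl rfl, k, rfl⟩, hF.trans (adjoin_mono b (Set.subset_insert _ _))⟩

/-- Independent realizations of countably many pairwise commuting types. -/
theorem IsSaturated.exists_independent [Countable J] (hs : IsSaturated L M κ) (hκ : ℵ₀ < κ)
    (hA : A.Countable) (p : ∀ x, GlobalType L M (Fin (n x)))
    (hcomm : ∀ x y, Commute κ A (p x) (p y)) :
    ∃ b : ∀ x, Fin (n x) → M, ∀ x, Realizes (p x) (adjoin A b {x}ᶜ) (b x) := by
  obtain ⟨enc, henc⟩ := exists_injective_nat J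
  have hr : ∀ (x : J) (B : Set M), B.Countable → ∃ a, Realizes (p x) B a := fun x B hB =>
    hs.exists_realizes hκ (mk_lt_of_countable hκ hB) (p x)
  have : ∀ x, Nonempty (Fin (n x) → M) := fun x => ⟨(hr x A hA).choose⟩
  choose! r hr using hr
  let c : ℕ → Set M := fun t =>
    Nat.rec A (fun t B => B ∪ {m | ∃ x, enc x = t ∧ ∃ k, r x B k = m}) t
  let b : ∀ x, Fin (n x) → M := fun x => r x (c (enc x))
  have hc : ∀ t, c t = adjoin A b {y | enc y < t} := by
    intro t
    induction t with
    | zero => simp [c, adjoin_empty]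
    | succ t ih =>
      change c t ∪ {m | ∃ x, enc x = t ∧ ∃ k, r x (c t) k = m} = _
      ext m
      constructor
      · rintro (hm | ⟨x, rfl, k, rfl⟩)
        · rw [ih] at hm
          exact adjoin_mono b (fun y (hy : enc y < t) => Nat.lt_succ_of_lt hy) hm
        · exact Or.inr ⟨x, Nat.lt_succ_self _, k, rfl⟩
      · rintro (hm | ⟨x, hx, k, rfl⟩)
        · rw [ih]
          exact Or.inl (Or.inl hm)
        · rcases Nat.lt_succ_iff_lt_or_eq.1 hx with hx | rfl
          · rw [ih]
            exact Or.inl (Or.inr ⟨x, hx, k, rfl⟩)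
          · exact Or.inr ⟨x, rfl, k, rfl⟩
  have hb : ∀ x, Realizes (p x) (adjoin A b {y | enc y < enc x}) (b x) := by
    intro x
    rw [← hc]
    exact hr x _ (by rw [hc]; exact countable_adjoin hA b _)
  -- `b x` was chosen generic over its predecessors only; commutation brings in each later tuple in
  -- turn.
  have key : ∀ t x, enc x < t → Realizes (p x) (adjoin A b {y | y ≠ x ∧ enc y < t}) (b x) := by
    intro t
    induction t with
    | zero => simp
    | succ t ih =>
      intro x hx
      rcases Nat.lt_succ_iff_lt_or_eq.1 hx with hx | rfl
      · by_cases hz : ∃ z, enc z = t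
        · obtain ⟨z, rfl⟩ := hz
          have h1 := hcomm x z (adjoin A b {y | y ≠ x ∧ enc y < enc z}) (subset_adjoin b _)
            (mk_lt_of_countable hκ (countable_adjoin hA b _)) _ (b z) (ih x hx) (by
              rw [← adjoin_insert]
              refine (hb z).mono (adjoin_mono b ?_)
              rintro y (rfl | hy)
              exacts [hx, hy.2])
          rw [← adjoin_insert] at h1
          refine h1.mono (adjoin_mono b fun y hy => ?_)
          rcases Nat.lt_succ_iff_lt_or_eq.1 hy.2 with h | h
          · exact Or.inr ⟨hy.1, h⟩
          · exact Or.inl (henc h)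
        · refine (ih x hx).mono (adjoin_mono b fun y hy => ⟨hy.1, ?_⟩)
          exact (Nat.lt_succ_iff_lt_or_eq.1 hy.2).resolve_right fun h => hz ⟨y, h⟩
      · refine (hb x).mono (adjoin_mono b fun y hy => ?_)
        exact (Nat.lt_succ_iff_lt_or_eq.1 hy.2).resolve_right fun h => hy.1 (henc h)
  refine ⟨b, fun x => realizes_of_finite fun E hE => ?_⟩
  obtain ⟨F, hF, hEF⟩ := exists_finset_subset_adjoin hE
  refine (key (F.sup enc + enc x + 1) x (by omega)).mono
    (hEF.trans (adjoin_mono b fun y hy => ⟨hF hy, ?_⟩))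
  have : enc y ≤ F.sup enc := Finset.le_sup hy
  omega

end Independence

end GenStab

/-! ### The model with prescribed dimensions. -/

theorem mainTheorem6 {L : FirstOrder.Language.{u, v}} [Countable L.Symbols]
    (T : L.Theory) (_hT : T.IsComplete)
    {M : Type w} [L.Structure M] (_hM : M ⊨ T)
    (κ : Cardinal.{w}) (hκ : ℵ₀ < κ) (hmonster : GenStab.IsMonster L M κ)
    (A : Set M) (hA : A.Countable)
    {I : Type*} [Countable I] (n : I → ℕ) (p : ∀ i, GenStab.GlobalType L M (Fin (n i)))
    (horth : ∀ i j, i ≠ j → GenStab.Orthogonal (p i) (p j))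
    (hreg : ∀ i, GenStab.RegularOver κ (p i) A)
    (hgs : ∀ i, GenStab.GenericallyStable κ (p i))
    (hiso : ∀ i, ¬ GenStab.IsIsolated (p i) A)
    (f : I → ℕ) :
    ∃ N : L.ElementarySubstructure M, (N : Set M).Countable ∧ A ⊆ (N : Set M) ∧
      ∀ i, GenStab.HasDim (p i) (N : Set M) A (f i : Cardinal.{w}) := by
  classical
  rcases isEmpty_or_nonempty M with hemp | hne
  · refine ⟨⊤, Set.to_countable _, fun m => isEmptyElim m, fun i => ?_⟩
    exact absurd (GenStab.nonempty_of_globalType (p i)) (not_nonempty_iff.2 hemp)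
  have hs := hmonster.saturated
  have hAκ : #A < κ := GenStab.mk_lt_of_countable hκ hA
  choose A₀ hA₀ hns using fun i => (hgs i).exists_noSplitting
  have hinv : ∀ i, GenStab.Invariant (p i) A := fun i => (hreg i).2.1
  have hcomm : ∀ i j, GenStab.Commute κ A (p i) (p j) := by
    intro i j
    rcases eq_or_ne i j with rfl | hij
    · exact (hns i).commute_self hs hκ (hA₀ i) (hinv i)
    · exact (horth i j hij).commute hs hκ (hinv i) (hinv j)
  obtain ⟨b, hb⟩ := hs.exists_independent (J := Σ i, Fin (f i)) hκ hA (fun x => p x.1)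
    (fun x y => hcomm x.1 y.1)
  have hadj : ∀ F, #(GenStab.adjoin A b F) < κ := fun F =>
    GenStab.mk_lt_of_countable hκ (GenStab.countable_adjoin hA b F)
  let K : I → Finset (Σ i, Fin (f i)) := fun i => Finset.univ.image fun j => ⟨i, j⟩
  have hK : ∀ i (j : Fin (f i)), (⟨i, j⟩ : Σ i, Fin (f i)) ∈ K i := fun i j =>
    Finset.mem_image_of_mem _ (Finset.mem_univ j)
  -- Over the tuples of index `i`, those of other indices are adjoined one by one by weak
  -- orthogonality.
  have hweak : ∀ i (F : Finset (Σ i, Fin (f i))) c,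
      GenStab.Realizes (p i) (GenStab.adjoin A b (K i)) c →
      GenStab.Realizes (p i) (GenStab.adjoin A b ((K i ∪ F : Finset _) : Set _)) c := by
    intro i F c hc
    induction F using Finset.induction_on with
    | empty => simpa using hc
    | insert x F hxF ih =>
      rw [Finset.union_insert]
      by_cases hx : x ∈ K i
      · rwa [Finset.insert_eq_of_mem (Finset.mem_union_left _ hx)]
      · rw [Finset.coe_insert, GenStab.adjoin_insert]
        have hxi : i ≠ x.1 := by
          rintro rfl
          exact hx (hK x.1 x.2)
        refine (hreg i).realizes_union_of_orthogonal hs hκ (hA₀ i) (hns i) (hinv x.1)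
          (hcomm _ _) (hcomm _ _) (horth _ _ hxi) (GenStab.subset_adjoin b _) (hadj _) ih
          ((hb x).mono (GenStab.adjoin_mono b ?_))
        rintro y hy rfl
        rcases Finset.mem_union.1 hy with h | h
        exacts [hx h, hxF h]
  have hniso : ∀ i (F : Finset (Σ i, Fin (f i))) (Y : Set (Fin (n i) → M)),
      (GenStab.adjoin A b F).Definable L Y → Y.Nonempty →
      ¬ ∀ y ∈ Y, GenStab.Realizes (p i) (GenStab.adjoin A b F) y := by
    intro i F
    induction F using Finset.induction_on with
    | empty =>
      intro Y hY hYne h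
      rw [Finset.coe_empty, GenStab.adjoin_empty] at hY h
      obtain ⟨y, hy⟩ := hYne
      exact hiso i (GenStab.isIsolated_iff.2 ⟨Y, hY, ((h y hy).mem_iff hY).1 hy, h⟩)
    | insert x F hxF ih =>
      intro Y hY hYne h
      rw [Finset.coe_insert, GenStab.adjoin_insert] at hY h
      obtain ⟨Z, hZ, hZne, hZ'⟩ := (hns x.1).exists_isolating hs hκ (hA₀ x.1) (hinv x.1)
        (hcomm x.1 i) (GenStab.subset_adjoin b F) (hadj _)
        ((hb x).mono (GenStab.adjoin_mono b (by rintro y hy rfl; exact hxF hy))) hY hYne h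
      exact ih Z hZ hZne hZ'
  obtain ⟨N, hNc, hBN, hN⟩ := hs.exists_omitting hκ
    (GenStab.countable_adjoin hA b Set.univ) n
    (fun i => {P | (GenStab.adjoin A b (K i)).Definable L P ∧ GenStab.Contains (p i) P})
    (fun i P hP => hP.1.mono (GenStab.adjoin_mono b (Set.subset_univ _)))
    (by
      intro i Y hY hYne
      by_contra! hcon
      -- `Y` uses finitely many parameters, so the passage down to `A` in `hniso` is a finite
      -- induction.
      obtain ⟨E, hE, hEY⟩ := Set.definable_iff_finitely_definable.1 hY
      obtain ⟨F, -, hF⟩ := GenStab.exists_finset_subset_adjoin hE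
      refine hniso i (K i ∪ F) Y (hEY.mono (hF.trans (GenStab.adjoin_mono b (by simp)))) hYne
        fun y hy => hweak i F y (GenStab.realizes_iff.2 fun P hP hpP => hcon P ⟨hP, hpP⟩ hy))
  refine ⟨N, hNc, (GenStab.subset_adjoin b _).trans hBN, fun i => ?_⟩
  -- The value from `f i` on is arbitrary: only positions below `f i` matter.
  let s : Ordinal.{w} → Fin (n i) → M := fun o =>
    if h : toNat o.card < f i then b ⟨i, ⟨toNat o.card, h⟩⟩ else fun _ => hne.some
  have hsb : ∀ j : Fin (f i), s (j : ℕ) = b ⟨i, j⟩ := by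
    intro j
    have h : toNat ((j : ℕ) : Ordinal.{w}).card = j := by simp
    have h' : ∀ (m : ℕ) (hm : m < f i), m = j → b ⟨i, ⟨m, hm⟩⟩ = b ⟨i, j⟩ := by
      rintro _ _ rfl
      rfl
    exact (dif_pos (h.trans_lt j.2)).trans (h' _ _ h)
  have hlt : ∀ o < (f i : Ordinal.{w}), ∃ j : Fin (f i), o = (j : ℕ) := by
    intro o ho
    obtain ⟨j, rfl⟩ := Ordinal.lt_omega0.1 (ho.trans (Ordinal.natCast_lt_omega0 _))
    exact ⟨⟨j, by exact_mod_cast ho⟩, rfl⟩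
  refine (hreg i).hasDim hκ hAκ (hcomm i i) (s := s) ⟨fun o ho => ?_, fun o ho k => ?_, ?_⟩
  · obtain ⟨j, rfl⟩ := hlt o ho
    rw [hsb]
    refine (hb ⟨i, j⟩).mono ?_
    rintro m (hm | ⟨o', ho', k, rfl⟩)
    · exact Or.inl hm
    · obtain ⟨j', rfl⟩ := hlt o' (ho'.trans ho)
      refine Or.inr ⟨⟨i, j'⟩, ?_, k, by rw [hsb]⟩
      have h1 : (j' : ℕ) < j := by exact_mod_cast ho'
      intro h
      obtain rfl : j' = j := by simpa using h
      exact lt_irrefl _ h1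
  · obtain ⟨j, rfl⟩ := hlt o ho
    rw [hsb]
    exact hBN (Or.inr ⟨⟨i, j⟩, trivial, k, rfl⟩)
  -- Maximality: a further term in `N` would realize the omitted restriction.
  · rintro ⟨c, hcN, hc⟩
    obtain ⟨P, hP, hcP⟩ := hN i c hcN
    refine hcP (GenStab.realizes_iff.1 (hc.mono ?_) P hP.1 hP.2)
    rintro m (hm | ⟨y, hy, k, rfl⟩)
    · exact Or.inl hm
    · obtain ⟨j, -, rfl⟩ := Finset.mem_image.1 hy
      exact Or.inr ⟨(j : ℕ), by exact_mod_cast j.2, k, by rw [hsb]⟩
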